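/- Let $d_x,d_y,N$ be natural numbers, and let $\sigma:\mathbb{R}\to\mathbb{R}$ be a non-degenerate activation function: $\sigma$ is continuous, is not a polynomial, and has a non-degenerating point, i.e. a point $z_0$ at which $\sigma$ is continuously differentiable (differentiable in a neighbourhood of $z_0$ with derivative continuous at $z_0$) and $\sigma'(z_0)\neq 0$. Put $\alpha(\sigma)=0$ if $\sigma$ is the ReLU $z\mapsto\max\{z,0\}$ or $\sigma(z_0)=0$ for some non-degenerating point $z_0$ of $\sigma$, and $\alpha(\sigma)=1$ otherwise. An RNN cell of width $d$ with parameters $A,B\in\mathbb{R}^{d\times d}$, $\theta\in\mathbb{R}^d$ maps $x=(x[1],\dots,x[N])\in\mathbb{R}^{d\times N}$ to the sequence $\mathcal{R}(x)[t+1]=\sigma\left(A\mathcal{R}(x)[t]+Bx[t+1]+\theta\right)$ for $0\le t<N$, where $\mathcal{R}(x)[0]=0$ and $\sigma$ acts componentwise. A backward RNN cell with parameters $\bar A,\bar B,\bar\theta$ is given by $\bar{\mathcal{R}}(x)[t-1]=\sigma\left(\bar A\bar{\mathcal{R}}(x)[t]+\bar Bx[t-1]+\bar\theta\right)$ for $2\le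 t\le N+1$, where $\bar{\mathcal{R}}(x)[N+1]=0$. A BRNN cell of width $d$ consists of an RNN cell $\mathcal{R}$, a backward RNN cell $\bar{\mathcal{R}}$ and matrices $W,\bar W\in\mathbb{R}^{d\times d}$, and maps $x$ to $\mathcal{BR}(x)[t]=W\mathcal{R}(x)[t]+\bar W\bar{\mathcal{R}}(x)[t]$. A BRNN of width $d$ is a composition $\mathcal{N}=\mathcal{Q}\circ\mathcal{BR}_L\circ\cdots\circ\mathcal{BR}_1\circ\mathcal{P}:\mathbb{R}^{d_x\times N}\to\mathbb{R}^{d_y\times N}$ of BRNN cells $\mathcal{BR}_l$ of width $d$ and token-wise linear maps $\mathcal{P}(x)[t]=Px[t]$, $\mathcal{Q}(s)[t]=Qs[t]$ with $P\in\mathbb{R}^{d\times d_x}$, $Q\in\mathbb{R}^{d_y\times d}$. It is deep if $L\ge 2$. Theorem. Let $f:\mathbb{R}^{d_x\times N}\to\mathbb{R}^{d_y\times N}$ be continuous. Then for every $\epsilon>0$ and every compact set $K\subset\mathbb{R}^{d_x}$ there is a deep BRNN $\mathcal{N}$ of width $d_x+d_y+3+\alpha(\sigma)$ with activation $\sigma$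 such that $$\sup_{x\in K^N}\ \sup_{1\le t\le N}\left\|f(x)[t]-\mathcal{N}(x)[t]\right\|<\epsilon,$$ where $\|\cdot\|$ is the Euclidean norm (and a supremum over the empty set is $0$). -/

import Mathlib

open scoped Matrix Topology ENNReal

namespace DeepBRNN

/-- A sequence `x[1], …, x[N]` of `N` tokens in `ℝ^d`; the token `x[t]` is `x (t - 1)`. -/
abbrev Sequence (d N : ℕ) : Type := Fin N → Fin d → ℝ

/-- The rectified linear unit. -/
def relu (z : ℝ) : ℝ := max z 0

/-- `z₀` is a non-degenerating point of `σ`: `σ` is continuously differentiable at `z₀`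
(differentiable near `z₀`, with derivative continuous at `z₀`), and `σ'(z₀) ≠ 0`. -/
def IsNondegeneratingPoint (σ : ℝ → ℝ) (z₀ : ℝ) : Prop :=
  (∀ᶠ z in 𝓝 z₀, DifferentiableAt ℝ σ z) ∧ ContinuousAt (deriv σ) z₀ ∧ deriv σ z₀ ≠ 0

/-- A non-degenerate activation: continuous, not a polynomial function, and with at least one
non-degenerating point. -/
def IsNondegenerate (σ : ℝ → ℝ) : Prop :=
  Continuous σ ∧ (¬ ∃ p : Polynomial ℝ, ∀ z, σ z = p.eval z) ∧
    ∃ z₀, IsNondegeneratingPoint σ z₀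

open Classical in
/-- The additional width: `0` if `σ` is ReLU or vanishes at some non-degenerating point,
and `1` otherwise. -/
noncomputable def alpha (σ : ℝ → ℝ) : ℕ :=
  if σ = relu ∨ ∃ z₀, IsNondegeneratingPoint σ z₀ ∧ σ z₀ = 0 then 0 else 1

/-- The parameters of an RNN cell acting on hidden states in `ℝ^d`. -/
structure RNNCell (d : ℕ) where
  A : Matrix (Fin d) (Fin d) ℝ
  B : Matrix (Fin d) (Fin d) ℝ
  θ : Fin d → ℝ

/-- The state `R(x)[t]` for `0 ≤ t ≤ N`: `R(x)[0] = 0` and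
`R(x)[t+1] = σ(A R(x)[t] + B x[t+1] + θ)`, with `σ` applied componentwise. -/
def RNNCell.state {d N : ℕ} (σ : ℝ → ℝ) (R : RNNCell d) (x : Sequence d N) :
    (t : ℕ) → t ≤ N → Fin d → ℝ
  | 0, _ => 0
  | t + 1, h => fun i =>
      σ ((R.A *ᵥ R.state σ x t (Nat.le_of_succ_le h) + R.B *ᵥ x ⟨t, h⟩ + R.θ) i)

/-- The RNN cell reading the sequence from `x[1]` to `x[N]`. -/
def RNNCell.forward {d N : ℕ} (σ : ℝ → ℝ) (R : RNNCell d) (x : Sequence d N) :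
    Sequence d N :=
  fun t => R.state σ x (t.val + 1) t.isLt

/-- The RNN cell reading the sequence from `x[N]` to `x[1]`:
`R(x)[N+1] = 0` and `R(x)[t-1] = σ(A R(x)[t] + B x[t-1] + θ)`. -/
def RNNCell.backward {d N : ℕ} (σ : ℝ → ℝ) (R : RNNCell d) (x : Sequence d N) :
    Sequence d N :=
  fun t => R.forward σ (fun s => x s.rev) t.rev

/-- The parameters of a bidirectional RNN cell acting on hidden states in `ℝ^d`. -/
structure BRNNCell (d : ℕ) where
  fwd : RNNCell d
  bwd : RNNCell d
  W : Matrix (Fin d) (Fin d) ℝ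
  Wbar : Matrix (Fin d) (Fin d) ℝ

/-- The map of a bidirectional cell: a token-wise linear combination of the outputs of
the forward and the backward cell. -/
def BRNNCell.eval {d N : ℕ} (σ : ℝ → ℝ) (C : BRNNCell d) (x : Sequence d N) :
    Sequence d N :=
  fun t => C.W *ᵥ C.fwd.forward σ x t + C.Wbar *ᵥ C.bwd.backward σ x t

/-- A bidirectional RNN of width `ds`: a lifting matrix `P`, bidirectional cells (the first one
in the list is applied first), and a projection matrix `Q`. -/
structure BRNN (dx ds dy : ℕ) where
  P : Matrix (Fin ds) (Fin dx) ℝ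
  cells : List (BRNNCell ds)
  Q : Matrix (Fin dy) (Fin ds) ℝ

/-- A network is deep if it stacks at least two cells. -/
def BRNN.IsDeep {dx ds dy : ℕ} (M : BRNN dx ds dy) : Prop := 2 ≤ M.cells.length

/-- The sequence-to-sequence map `Q ∘ C_L ∘ ⋯ ∘ C_1 ∘ P`, with `P` and `Q` acting token-wise. -/
def BRNN.eval {dx ds dy N : ℕ} (σ : ℝ → ℝ) (M : BRNN dx ds dy) (x : Sequence dx N) :
    Sequence dy N :=
  fun t => M.Q *ᵥ (M.cells.foldl (fun h C => C.eval σ h) (fun s => M.P *ᵥ x s)) t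

end DeepBRNN

namespace DeepBRNN

open MeasureTheory

/-! Stacks of cells act as programs of a register machine on tokens. Since `σ'(z₀) ≠ 0`, the
rescaled activation `(σ(δz + z₀) - σ(z₀)) / (δ σ'(z₀))` tends to `z` uniformly on bounded sets as `δ
→ 0`, so a cell can nearly copy coordinates. The offset `σ(z₀)` is supplied as a constant by the
backward half of the cell; hence `dx + dy + 3` coordinates suffice for every `σ`, and the `α(σ)`
further ones are idle. Uniform approximation on compact sets is stable under composition
(`Realizable.comp`), so ideal instructions can be composed without tracking errors.

The instructions are: a linear map plus one ridge function of the token (`realizable_ridge`), hence,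
by density of ridge functions (`isCompactLimit_ridgeSpan`), adding to one register any continuous
function of the others (`realizable_add`); writing a distinct number at each position
(`realizable_clock`), which makes such functions position-dependent (`realizable_add_clock`); and
partial sums in both directions (`realizable_cumsum` and its reversal).

Functions `exp ∘ l` with `l` linear on whole sequences span a dense space. To add such a term to one
output entry (`computes_ridge`), each token computes its share of `l x`, a forward sum collects the
shares at the last token, and a backward sum broadcasts the total. The input registers survive, so
the terms are added one after another with the same two work registers. -/

/-! ### Density of the affine reparametrizations of a non-polynomial function on the line -/

/-- The restriction to `K` of `x ↦ x ^ k * g (a * x + b)`. -/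
def powMulAffine (K : Set ℝ) (k : ℕ) (g : ℝ → ℝ) (hg : Continuous g) (a b : ℝ) : C(K, ℝ) :=
  ⟨fun x => (x : ℝ) ^ k * g (a * x + b), by fun_prop⟩

@[simp] lemma powMulAffine_apply (K : Set ℝ) (k : ℕ) (g : ℝ → ℝ) (hg : Continuous g) (a b : ℝ)
    (x : K) : powMulAffine K k g hg a b x = (x : ℝ) ^ k * g (a * x + b) := rfl

lemma continuous_powMulAffine (K : Set ℝ) (k : ℕ) (g : ℝ → ℝ) (hg : Continuous g) (a b : ℝ → ℝ)
    (ha : Continuous a) (hb : Continuous b) :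
    Continuous fun s => powMulAffine K k g hg (a s) (b s) := by
  apply ContinuousMap.continuous_of_continuous_uncurry
  simp only [Function.uncurry_def, powMulAffine_apply]
  fun_prop

lemma hasDerivAt_mem_of_isClosed {E : Type*} [NormedAddCommGroup E] [NormedSpace ℝ E]
    (S : Submodule ℝ E) (hS : IsClosed (S : Set E)) (F : ℝ → E) (hF : ∀ a, F a ∈ S) (F' : E) (a : ℝ)
    (h : HasDerivAt F F' a) : F' ∈ S := by
  rw [hasDerivAt_iff_tendsto_slope] at h
  refine hS.mem_of_tendsto h (Filter.Eventually.of_forall fun y => ?_)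
  rw [slope_def_module]
  exact S.smul_mem _ (S.sub_mem (hF _) (hF _))

/-- A closed subspace is itself complete, so the integral can be formed inside it. -/
lemma integral_mem_of_isClosed {E : Type*} [NormedAddCommGroup E] [NormedSpace ℝ E]
    [CompleteSpace E] (S : Submodule ℝ E) (hS : IsClosed (S : Set E)) (F : ℝ → E)
    (hF : ∀ t, F t ∈ S) (hc : Continuous F) (hs : HasCompactSupport F) : ∫ t, F t ∈ S := by
  have : CompleteSpace S := hS.completeSpace_coe
  let F' : ℝ → S := fun t => ⟨F t, hF t⟩
  have hc' : Continuous F' := hc.subtype_mk hF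
  have hs' : HasCompactSupport F' := by
    refine hs.mono fun t ht => ?_
    simpa [F', Function.mem_support] using ht
  have := S.subtypeL.integral_comp_comm (hc'.integrable_of_hasCompactSupport hs' (μ := volume))
  simp only [Submodule.subtypeL_apply, F'] at this
  rw [this]
  exact (∫ t, F' t).2

/-- Differentiating in the slope `a` brings down a factor `x`. For the derivative to exist in the
sup norm, the curve is written as an integral of a continuous `C(K, ℝ)`-valued curve; the pointwise
identity is the scalar fundamental theorem. -/
lemma hasDerivAt_powMulAffine (K : Set ℝ) [CompactSpace K] (k : ℕ) (g g' : ℝ → ℝ)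
    (hg : Continuous g) (hg' : Continuous g') (h : ∀ z, HasDerivAt g (g' z) z) (a b : ℝ) :
    HasDerivAt (fun a => powMulAffine K k g hg a b) (powMulAffine K (k + 1) g' hg' a b) a := by
  have hc : Continuous fun s => powMulAffine K (k + 1) g' hg' s b :=
    continuous_powMulAffine K _ _ _ _ _ continuous_id continuous_const
  have key : (fun a => powMulAffine K k g hg a b) = fun a =>
      powMulAffine K k g hg 0 b + ∫ s in (0 : ℝ)..a, powMulAffine K (k + 1) g' hg' s b := by
    funext a
    ext x
    have h1 := (ContinuousMap.evalCLM ℝ x).intervalIntegral_comp_comm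
      (hc.intervalIntegrable (μ := volume) 0 a)
    simp only [ContinuousMap.evalCLM_apply] at h1
    rw [ContinuousMap.add_apply, ← h1]
    simp only [powMulAffine_apply]
    rw [intervalIntegral.integral_eq_sub_of_hasDerivAt
      (f := fun s : ℝ => (x : ℝ) ^ k * g (s * x + b))]
    · simp
    · intro s _
      have h2 : HasDerivAt (fun s : ℝ => s * (x : ℝ) + b) x s := by
        simpa using ((hasDerivAt_id s).mul_const (x : ℝ)).add_const b
      have h3 := ((h (s * x + b)).comp s h2).const_mul ((x : ℝ) ^ k)
      have h4 : (x : ℝ) ^ (k + 1) * g' (s * x + b) = (x : ℝ) ^ k * (g' (s * x + b) * x) := by ring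
      rw [h4]
      exact h3
    · apply Continuous.intervalIntegrable
      fun_prop
  rw [key]
  exact (intervalIntegral.integral_hasDerivAt_right (hc.intervalIntegrable _ _)
    (hc.stronglyMeasurableAtFilter _ _) hc.continuousAt).const_add _

/-- If a smooth function has all its affine reparametrizations in a closed subspace, then the
subspace contains every monomial `x ^ k` for which the `k`-th derivative does not vanish. -/
lemma powMulAffine_iteratedDeriv_mem (K : Set ℝ) [CompactSpace K] (S : Submodule ℝ C(K, ℝ))
    (hS : IsClosed (S : Set C(K, ℝ))) (g : ℝ → ℝ) (hg : ContDiff ℝ (⊤ : ℕ∞) g)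
    (h : ∀ a b, powMulAffine K 0 g hg.continuous a b ∈ S) (k : ℕ) :
    ∀ a b, powMulAffine K k (iteratedDeriv k g)
      (hg.continuous_iteratedDeriv k (by exact_mod_cast le_top)) a b ∈ S := by
  induction k with
  | zero => simpa using h
  | succ k ih =>
    intro a b
    refine hasDerivAt_mem_of_isClosed S hS _ (fun a => ih a b) _ a
      (hasDerivAt_powMulAffine K k _ _ _ _ (fun z => ?_) a b)
    rw [iteratedDeriv_succ]
    exact ((hg.differentiable_iteratedDeriv k (by exact_mod_cast WithTop.coe_lt_top _)) z).hasDerivAt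

lemma exists_derivative_eq_of_degree_lt (p : Polynomial ℝ) (k : ℕ) (hp : p.degree < k) :
    ∃ q : Polynomial ℝ, q.degree < (k + 1 : ℕ) ∧ q.derivative = p := by
  refine ⟨∑ i ∈ Finset.range k, Polynomial.monomial (i + 1) (p.coeff i / (i + 1)), ?_, ?_⟩
  · rw [← Polynomial.mem_degreeLT]
    refine Submodule.sum_mem _ fun i hi => ?_
    rw [Polynomial.mem_degreeLT]
    refine (Polynomial.degree_monomial_le _ _).trans_lt ?_
    have := Finset.mem_range.1 hi
    exact_mod_cast Nat.succ_lt_succ this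
  · simp only [Polynomial.derivative_sum, Polynomial.derivative_monomial, Nat.add_sub_cancel]
    by_cases h0 : p = 0
    · simp [h0]
    rw [p.as_sum_range' k ((Polynomial.natDegree_lt_iff_degree_lt h0).2 hp)]
    refine Finset.sum_congr rfl fun i _ => ?_
    congr 1
    rw [← p.as_sum_range' k ((Polynomial.natDegree_lt_iff_degree_lt h0).2 hp)]
    push_cast
    field_simp

lemma exists_polynomial_of_iteratedDeriv_eq_zero (k : ℕ) : ∀ (g : ℝ → ℝ),
    ContDiff ℝ (⊤ : ℕ∞) g → (∀ z, iteratedDeriv k g z = 0) →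
    ∃ p : Polynomial ℝ, p.degree < k ∧ ∀ z, g z = p.eval z := by
  induction k with
  | zero => exact fun g _ h => ⟨0, by simp, fun z => by simpa using h z⟩
  | succ k ih =>
    intro g hg h
    have hg' : ContDiff ℝ (⊤ : ℕ∞) (deriv g) := by
      exact (contDiff_infty_iff_deriv.1 hg).2
    obtain ⟨p, hp, hpe⟩ := ih (deriv g) hg' (fun z => by rw [← iteratedDeriv_succ']; exact h z)
    obtain ⟨q, hq, hqd⟩ := exists_derivative_eq_of_degree_lt p k hp
    have hconst : ∀ x y, g x - q.eval x = g y - q.eval y := by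
      apply is_const_of_deriv_eq_zero
      · exact (hg.differentiable (by simp)).sub q.differentiable
      · intro x
        rw [deriv_fun_sub (hg.differentiable (by simp) x) q.differentiableAt, Polynomial.deriv,
          hqd, hpe, sub_self]
    refine ⟨q + Polynomial.C (g 0 - q.eval 0), ?_, fun z => ?_⟩
    · refine (Polynomial.degree_add_le _ _).trans_lt (max_lt hq ?_)
      exact Polynomial.degree_C_le.trans_lt (by exact_mod_cast Nat.succ_pos k)
    · simp only [Polynomial.eval_add, Polynomial.eval_C]
      linarith [hconst z 0]

/-- A pointwise limit of polynomial functions of bounded degree is a polynomial function. -/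
lemma exists_polynomial_of_tendsto (k : ℕ) (σ : ℝ → ℝ) (p : ℕ → Polynomial ℝ)
    (hp : ∀ n, (p n).degree < k)
    (h : ∀ z, Filter.Tendsto (fun n => (p n).eval z) Filter.atTop (𝓝 (σ z))) :
    ∃ q : Polynomial ℝ, ∀ z, σ z = q.eval z := by
  have hinj : Set.InjOn (fun i : ℕ => (i : ℝ)) (Finset.range k : Set ℕ) :=
    Nat.cast_injective.injOn
  -- A polynomial of degree less than `k` is fixed by its values at `0, …, k - 1`, so the limit is
  -- the interpolant of the limiting values.
  refine ⟨Lagrange.interpolate (Finset.range k) (fun i : ℕ => (i : ℝ)) (fun i => σ i),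
    fun z => tendsto_nhds_unique (h z) ?_⟩
  have h1 : ∀ n, (p n).eval z = ∑ i ∈ Finset.range k, (p n).eval (i : ℝ) *
      (Lagrange.basis (Finset.range k) (fun i : ℕ => (i : ℝ)) i).eval z := by
    intro n
    conv_lhs => rw [Lagrange.eq_interpolate (f := p n) (s := Finset.range k) hinj
      (by simpa using hp n)]
    simp [Lagrange.interpolate_apply, Polynomial.eval_finsetSum]
  simp only [h1, Lagrange.interpolate_apply, Polynomial.eval_finsetSum, Polynomial.eval_mul,
    Polynomial.eval_C]
  exact tendsto_finsetSum _ fun i _ => (h i).mul_const _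

open scoped Convolution in
/-- Mollifications of `σ` by smooth bumps. -/
noncomputable def mollify (σ : ℝ → ℝ) (φ : ContDiffBump (0 : ℝ)) : ℝ → ℝ :=
  φ.normed volume ⋆[ContinuousLinearMap.lsmul ℝ ℝ, volume] σ

lemma contDiff_mollify (σ : ℝ → ℝ) (hσ : Continuous σ) (φ : ContDiffBump (0 : ℝ)) :
    ContDiff ℝ (⊤ : ℕ∞) (mollify σ φ) :=
  φ.hasCompactSupport_normed.contDiff_convolution_left _ φ.contDiff_normed
    hσ.locallyIntegrable

/-- Convolution is an integral of translates, and translating `σ` only changes `b`. -/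
lemma powMulAffine_mollify_mem (K : Set ℝ) [CompactSpace K] (S : Submodule ℝ C(K, ℝ))
    (hS : IsClosed (S : Set C(K, ℝ))) (σ : ℝ → ℝ) (hσ : Continuous σ) (φ : ContDiffBump (0 : ℝ))
    (h : ∀ a b, powMulAffine K 0 σ hσ a b ∈ S) (a b : ℝ) :
    powMulAffine K 0 (mollify σ φ) (contDiff_mollify σ hσ φ).continuous a b ∈ S := by
  have hc : Continuous fun t => φ.normed volume t • powMulAffine K 0 σ hσ a (b - t) :=
    φ.continuous_normed.smul
      (continuous_powMulAffine K _ _ _ _ _ continuous_const (continuous_const.sub continuous_id))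
  have hs : HasCompactSupport fun t => φ.normed volume t • powMulAffine K 0 σ hσ a (b - t) :=
    φ.hasCompactSupport_normed.smul_right
  have := integral_mem_of_isClosed S hS _ (fun t => S.smul_mem _ (h a (b - t))) hc hs
  convert this using 1
  ext x
  have h1 := (ContinuousMap.evalCLM ℝ x).integral_comp_comm
      (hc.integrable_of_hasCompactSupport hs (μ := volume))
  simp only [ContinuousMap.evalCLM_apply] at h1
  rw [← h1]
  simp [mollify, convolution_def, add_sub_assoc]

/-- The closed subspace spanned by all affine reparametrizations of a continuous non-polynomial
function contains every continuous function on a compact set. -/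
lemma eq_top_of_powMulAffine_mem (K : Set ℝ) [CompactSpace K] (S : Submodule ℝ C(K, ℝ))
    (hS : IsClosed (S : Set C(K, ℝ))) (σ : ℝ → ℝ) (hσ : Continuous σ)
    (hpoly : ¬ ∃ p : Polynomial ℝ, ∀ z, σ z = p.eval z)
    (h : ∀ a b, powMulAffine K 0 σ hσ a b ∈ S) : S = ⊤ := by
  have hmon : ∀ k, powMulAffine K k (fun _ => 1) continuous_const 0 0 ∈ S := by
    intro k
    by_contra hk
    -- Slope `0` and shift `z` turn the `k`-th derivative into a constant times `x ^ k`; a nonzero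
    -- constant would put the monomial in `S`.
    have h0 : ∀ (φ : ContDiffBump (0 : ℝ)) z, iteratedDeriv k (mollify σ φ) z = 0 := by
      intro φ z
      by_contra hz
      apply hk
      have h1 := S.smul_mem (iteratedDeriv k (mollify σ φ) z)⁻¹
        (powMulAffine_iteratedDeriv_mem K S hS _ (contDiff_mollify σ hσ φ)
        (powMulAffine_mollify_mem K S hS σ hσ φ h) k 0 z)
      convert h1 using 1
      ext x
      simp
      field_simp
    let φ : ℕ → ContDiffBump (0 : ℝ) := fun n =>
      ⟨1 / (n + 1) / 2, 1 / (n + 1), by positivity, half_lt_self (by positivity)⟩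
    choose p hp hpe using fun n => exists_polynomial_of_iteratedDeriv_eq_zero k _
      (contDiff_mollify σ hσ (φ n)) (h0 (φ n))
    -- The degree bound `k` is the same for all mollifications, so it survives the limit and makes
    -- `σ` a polynomial.
    refine hpoly (exists_polynomial_of_tendsto k σ p hp fun z => ?_)
    simp only [← hpe]
    exact ContDiffBump.convolution_tendsto_right_of_continuous
      tendsto_one_div_add_atTop_nhds_zero_nat hσ z
  have hle : (Subalgebra.toSubmodule (polynomialFunctions K) : Submodule ℝ C(K, ℝ)) ≤ S := by
    rintro _ ⟨p, -, rfl⟩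
    have : ((Polynomial.toContinuousMapOnAlgHom K) p : C(K, ℝ)) =
        ∑ i ∈ Finset.range (p.natDegree + 1),
          p.coeff i • powMulAffine K i (fun _ => 1) continuous_const 0 0 := by
      ext x
      simp [Polynomial.eval_eq_sum_range, ContinuousMap.sum_apply]
    change (Polynomial.toContinuousMapOnAlgHom K) p ∈ S
    rw [this]
    exact S.sum_mem fun i _ => S.smul_mem _ (hmon i)
  have hd := ContinuousMap.subalgebra_topologicalClosure_eq_top_of_separatesPoints _
    (polynomialFunctions_separatesPoints K)
  rw [eq_top_iff]
  intro f _
  have hf : f ∈ closure ((polynomialFunctions K : Subalgebra ℝ C(K, ℝ)) : Set C(K, ℝ)) := by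
    rw [← Subalgebra.topologicalClosure_coe, hd]
    trivial
  exact closure_minimal (fun y hy => hle hy) hS hf

/-! ### Density of ridge functions in several variables -/

/-- `f` is a limit of elements of `V`, uniformly on compact sets. -/
def IsCompactLimit {E : Type*} [TopologicalSpace E] (V : Submodule ℝ (E → ℝ)) (f : E → ℝ) : Prop :=
  ∀ K : Set E, IsCompact K → ∀ ε > 0, ∃ h ∈ V, ∀ x ∈ K, |f x - h x| < ε

/-- Transfers approximants found in `C(X, ℝ)` for a compact `X` to functions defined on all of `E`;
`π` is the identity for exponentials and a linear functional for ridge functions. -/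
lemma exists_mem_span_of_restrict {E X : Type*} [TopologicalSpace X] {ι : Type*}
    (V : Submodule ℝ (E → ℝ)) (K : Set E) (π : K → X) (F : ι → C(X, ℝ))
    (hF : ∀ i, ∃ h ∈ V, ∀ x : K, F i (π x) = h x) (q : C(X, ℝ))
    (hq : q ∈ Submodule.span ℝ (Set.range F)) : ∃ h ∈ V, ∀ x : K, q (π x) = h x := by
  induction hq using Submodule.span_induction with
  | mem q hq => obtain ⟨i, rfl⟩ := hq; exact hF i
  | zero => exact ⟨0, V.zero_mem, fun _ => rfl⟩
  | add p q _ _ hp hq =>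
    obtain ⟨h, hV, hh⟩ := hp
    obtain ⟨h', hV', hh'⟩ := hq
    exact ⟨h + h', V.add_mem hV hV', fun x => by simp [hh, hh']⟩
  | smul c q _ hq =>
    obtain ⟨h, hV, hh⟩ := hq
    exact ⟨c • h, V.smul_mem c hV, fun x => by simp [hh]⟩

lemma IsCompactLimit.trans {E : Type*} [TopologicalSpace E] {V W : Submodule ℝ (E → ℝ)} {f : E → ℝ}
    (hf : IsCompactLimit V f)
    (h : ∀ g ∈ V, IsCompactLimit W g) : IsCompactLimit W f := by
  intro K hK ε hε
  obtain ⟨g, hg, hfg⟩ := hf K hK (ε / 2) (half_pos hε)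
  obtain ⟨k, hk, hgk⟩ := h g hg K hK (ε / 2) (half_pos hε)
  refine ⟨k, hk, fun x hx => ?_⟩
  have := abs_sub_le (f x) (g x) (k x)
  linarith [hfg x hx, hgk x hx]

lemma isCompactLimit_of_mem_span {E : Type*} [TopologicalSpace E] {W : Submodule ℝ (E → ℝ)} 
    {s : Set (E → ℝ)} (hs : ∀ g ∈ s, IsCompactLimit W g) :
    ∀ g ∈ Submodule.span ℝ s, IsCompactLimit W g := by
  intro g hg
  induction hg using Submodule.span_induction with
  | mem q hq => exact hs q hq
  | zero => exact fun K hK ε hε => ⟨0, W.zero_mem, fun x _ => by simpa⟩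
  | add p q _ _ hp hq =>
    intro K hK ε hε
    obtain ⟨h, hV, hh⟩ := hp K hK (ε / 2) (half_pos hε)
    obtain ⟨h', hV', hh'⟩ := hq K hK (ε / 2) (half_pos hε)
    refine ⟨h + h', W.add_mem hV hV', fun x hx => ?_⟩
    have := abs_add_le (p x - h x) (q x - h' x)
    simp only [Pi.add_apply]
    rw [add_sub_add_comm]
    linarith [hh x hx, hh' x hx]
  | smul c q _ hq =>
    intro K hK ε hε
    obtain ⟨h, hV, hh⟩ := hq K hK (ε / (|c| + 1)) (by positivity)
    refine ⟨c • h, W.smul_mem c hV, fun x hx => ?_⟩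
    simp only [Pi.smul_apply, smul_eq_mul]
    rw [← mul_sub, abs_mul]
    have h1 := hh x hx
    rw [lt_div_iff₀ (by positivity)] at h1
    nlinarith [abs_nonneg (q x - h x), abs_nonneg c]

section Density

variable {E : Type*} [NormedAddCommGroup E] [NormedSpace ℝ E]

/-- The span of the exponentials of continuous linear functionals. -/
def expSpan (E : Type*) [NormedAddCommGroup E] [NormedSpace ℝ E] : Submodule ℝ (E → ℝ) :=
  Submodule.span ℝ (Set.range fun (l : E →L[ℝ] ℝ) x => Real.exp (l x))

/-- The span of the ridge functions with profile `σ`. -/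
def ridgeSpan (E : Type*) [NormedAddCommGroup E] [NormedSpace ℝ E] (σ : ℝ → ℝ) :
    Submodule ℝ (E → ℝ) :=
  Submodule.span ℝ (Set.range fun (p : (E →L[ℝ] ℝ) × ℝ) x => σ (p.1 x + p.2))

/-- Products of exponentials are exponentials, so their span is already an algebra, and linear
functionals separate points: Stone–Weierstrass applies. -/
lemma isCompactLimit_expSpan (f : E → ℝ) (hf : Continuous f) : IsCompactLimit (expSpan E) f := by
  intro K hK ε hε
  have : CompactSpace K := isCompact_iff_compactSpace.1 hK
  let F : (E →L[ℝ] ℝ) → C(K, ℝ) := fun l => ⟨fun x => Real.exp (l x), by fun_prop⟩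
  let M : Submonoid C(K, ℝ) :=
    { carrier := Set.range F
      one_mem' := ⟨0, by ext x; simp [F]⟩
      mul_mem' := by
        rintro _ _ ⟨l, rfl⟩ ⟨l', rfl⟩
        exact ⟨l + l', by ext x; simp [F, Real.exp_add]⟩ }
  have hsep : (Algebra.adjoin ℝ (M : Set C(K, ℝ))).SeparatesPoints := by
    intro x y hxy
    have hne : (x : E) - y ≠ 0 := sub_ne_zero.2 (Subtype.coe_injective.ne hxy)
    obtain ⟨l, hl⟩ := SeparatingDual.exists_ne_zero (R := ℝ) hne
    refine ⟨_, ⟨F l, Algebra.subset_adjoin ⟨l, rfl⟩, rfl⟩, fun h => hl ?_⟩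
    have : l x = l y := Real.exp_injective h
    rw [map_sub, this, sub_self]
  have hd := ContinuousMap.subalgebra_topologicalClosure_eq_top_of_separatesPoints _ hsep
  have hmem : (⟨fun x : K => f x, by fun_prop⟩ : C(K, ℝ)) ∈
      closure ((Algebra.adjoin ℝ (M : Set C(K, ℝ)) : Subalgebra ℝ C(K, ℝ)) : Set C(K, ℝ)) := by
    rw [← Subalgebra.topologicalClosure_coe, hd]
    trivial
  obtain ⟨q, hq, hqd⟩ := Metric.mem_closure_iff.1 hmem ε hε
  have hq' : q ∈ Submodule.span ℝ (Set.range F) := by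
    have : q ∈ Subalgebra.toSubmodule (Algebra.adjoin ℝ (M : Set C(K, ℝ))) := hq
    rw [Algebra.adjoin_eq_span, Submonoid.closure_eq] at this
    exact this
  obtain ⟨h, hV, hh⟩ := exists_mem_span_of_restrict (expSpan E) K id F
    (fun l => ⟨_, Submodule.subset_span ⟨l, rfl⟩, fun x => rfl⟩) q hq'
  refine ⟨h, hV, fun x hx => ?_⟩
  have := (ContinuousMap.dist_lt_iff hε).1 hqd ⟨x, hx⟩
  rw [Real.dist_eq] at this
  simpa [← hh ⟨x, hx⟩] using this

/-- Only the values of `l` matter, so the one-variable density is applied on the compact set `l ''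
K`. -/
lemma isCompactLimit_ridgeSpan_exp (σ : ℝ → ℝ) (hσ : Continuous σ)
    (hpoly : ¬ ∃ p : Polynomial ℝ, ∀ z, σ z = p.eval z) (l : E →L[ℝ] ℝ) :
    IsCompactLimit (ridgeSpan E σ) fun x => Real.exp (l x) := by
  intro K hK ε hε
  have hI : IsCompact (l '' K) := hK.image l.continuous
  have : CompactSpace (l '' K) := isCompact_iff_compactSpace.1 hI
  let F : ℝ × ℝ → C(l '' K, ℝ) := fun p => powMulAffine (l '' K) 0 σ hσ p.1 p.2
  have htop := eq_top_of_powMulAffine_mem (l '' K)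
    (Submodule.span ℝ (Set.range F)).topologicalClosure
    (Submodule.isClosed_topologicalClosure _) σ hσ hpoly
    (fun a b => Submodule.le_topologicalClosure _ (Submodule.subset_span ⟨(a, b), rfl⟩))
  have hmem : (⟨fun x : l '' K => Real.exp x, by fun_prop⟩ : C(l '' K, ℝ)) ∈
      closure (Submodule.span ℝ (Set.range F) : Set C(l '' K, ℝ)) := by
    rw [← Submodule.topologicalClosure_coe, htop]
    trivial
  obtain ⟨q, hq, hqd⟩ := Metric.mem_closure_iff.1 hmem ε hε
  obtain ⟨h, hV, hh⟩ := exists_mem_span_of_restrict (ridgeSpan E σ) K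
    (fun x => (⟨l x, Set.mem_image_of_mem l x.2⟩ : l '' K)) F
    (fun p => ⟨_, Submodule.subset_span ⟨(p.1 • l, p.2), rfl⟩, fun x => by simp [F]⟩) q hq
  refine ⟨h, hV, fun x hx => ?_⟩
  have := (ContinuousMap.dist_lt_iff hε).1 hqd ⟨l x, Set.mem_image_of_mem l hx⟩
  rw [Real.dist_eq] at this
  rw [← hh ⟨x, hx⟩]
  exact this

/-- Universal approximation: ridge functions with a continuous non-polynomial profile span a dense
subspace of the continuous functions, uniformly on compact sets. -/
lemma isCompactLimit_ridgeSpan (σ : ℝ → ℝ) (hσ : Continuous σ)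
    (hpoly : ¬ ∃ p : Polynomial ℝ, ∀ z, σ z = p.eval z) (f : E → ℝ) (hf : Continuous f) :
    IsCompactLimit (ridgeSpan E σ) f := by
  refine (isCompactLimit_expSpan f hf).trans (isCompactLimit_of_mem_span ?_)
  rintro _ ⟨l, rfl⟩
  exact isCompactLimit_ridgeSpan_exp σ hσ hpoly l

end Density

/-! ### Stacks of cells and the maps they approximate -/

variable {d N : ℕ}

lemma RNNCell.continuous_state (σ : ℝ → ℝ) (hσ : Continuous σ) (R : RNNCell d) (t : ℕ)
    (h : t ≤ N) : Continuous fun x : Sequence d N => R.state σ x t h := by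
  induction t with
  | zero => exact continuous_const
  | succ t ih =>
    have := ih (Nat.le_of_succ_le h)
    simp only [RNNCell.state]
    refine continuous_pi fun i => hσ.comp ?_
    refine (continuous_apply i).comp ((Continuous.add ?_ ?_).add continuous_const)
    · exact continuous_const.matrix_mulVec this
    · exact continuous_const.matrix_mulVec (continuous_apply _)

lemma BRNNCell.continuous_eval (σ : ℝ → ℝ) (hσ : Continuous σ) (C : BRNNCell d) :
    Continuous fun x : Sequence d N => C.eval σ x := by
  refine continuous_pi fun t => Continuous.add ?_ ?_
  · exact continuous_const.matrix_mulVec (C.fwd.continuous_state σ hσ _ _)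
  · refine continuous_const.matrix_mulVec ?_
    exact (C.bwd.continuous_state σ hσ _ t.rev.isLt).comp
      (continuous_pi fun s => continuous_apply s.rev)

/-- The composition of a list of cells, the first one being applied first. -/
def run (σ : ℝ → ℝ) (L : List (BRNNCell d)) (x : Sequence d N) : Sequence d N :=
  L.foldl (fun h C => C.eval σ h) x

lemma run_append (σ : ℝ → ℝ) (L L' : List (BRNNCell d)) (x : Sequence d N) :
    run σ (L ++ L') x = run σ L' (run σ L x) := by
  simp [run]

lemma continuous_run (σ : ℝ → ℝ) (hσ : Continuous σ) (L : List (BRNNCell d)) :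
    Continuous (run (N := N) σ L) := by
  induction L with
  | nil => exact continuous_id
  | cons C L ih => exact ih.comp (C.continuous_eval σ hσ)

/-- The map `T` is approximated by nonempty stacks of cells, uniformly on compact subsets
of `S`. -/
def Realizable (σ : ℝ → ℝ) (S : Set (Sequence d N)) (T : Sequence d N → Sequence d N) : Prop :=
  ∀ C ⊆ S, IsCompact C → ∀ ε > 0, ∃ L : List (BRNNCell d), L ≠ [] ∧
    ∀ x ∈ C, dist (run σ L x) (T x) < ε

/-- Only `y` is confined to the compact set: in a composition, the approximate output `z` of the
first stack may leave it. -/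
lemma exists_dist_lt_of_continuous {X Y : Type*} [PseudoMetricSpace X] [PseudoMetricSpace Y]
    (F : X → Y) (hF : Continuous F) (C : Set X) (hC : IsCompact C) (ε : ℝ) (hε : 0 < ε) :
    ∃ δ > 0, ∀ y ∈ C, ∀ z, dist z y < δ → dist (F z) (F y) < ε := by
  have := hC.uniformContinuousAt_of_continuousAt F (fun a _ => hF.continuousAt)
    (Metric.dist_mem_uniformity hε)
  obtain ⟨δ, hδ, h⟩ := Metric.mem_uniformity_dist.1 this
  refine ⟨δ, hδ, fun y hy z hz => ?_⟩
  have h1 := @h y z (by rwa [dist_comm]) hy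
  rw [dist_comm]
  exact h1

namespace Realizable

variable {σ : ℝ → ℝ} {S S' : Set (Sequence d N)} {T T' : Sequence d N → Sequence d N}

lemma mono (h : Realizable σ S T) (hS : S' ⊆ S) : Realizable σ S' T :=
  fun C hC => h C (hC.trans hS)

lemma congr (h : Realizable σ S T) (hT : ∀ x ∈ S, T x = T' x) : Realizable σ S T' := by
  intro C hC hK ε hε
  obtain ⟨L, hL, hd⟩ := h C hC hK ε hε
  exact ⟨L, hL, fun x hx => hT x (hC hx) ▸ hd x hx⟩

lemma of_limit (h : ∀ C ⊆ S, IsCompact C → ∀ ε > 0, ∃ T', Realizable σ S T' ∧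
    ∀ x ∈ C, dist (T' x) (T x) < ε) : Realizable σ S T := by
  intro C hC hK ε hε
  obtain ⟨T', hT', hd'⟩ := h C hC hK (ε / 2) (half_pos hε)
  obtain ⟨L, hL, hd⟩ := hT' C hC hK (ε / 2) (half_pos hε)
  refine ⟨L, hL, fun x hx => ?_⟩
  have := dist_triangle (run σ L x) (T' x) (T x)
  linarith [hd x hx, hd' x hx]

lemma of_cell (h : ∀ C ⊆ S, IsCompact C → ∀ ε > 0, ∃ c : BRNNCell d,
    ∀ x ∈ C, dist (c.eval σ x) (T x) < ε) : Realizable σ S T := by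
  intro C hC hK ε hε
  obtain ⟨c, hc⟩ := h C hC hK ε hε
  exact ⟨[c], by simp, hc⟩

/-- A uniform limit of continuous maps is continuous. This makes the image of a compact set compact,
as the second stack of a composition requires. -/
lemma continuousOn (h : Realizable σ S T) (hσ : Continuous σ) (C : Set (Sequence d N))
    (hC : C ⊆ S) (hK : IsCompact C) : ContinuousOn T C := by
  refine continuousOn_of_uniform_approx_of_continuousOn fun u hu => ?_
  obtain ⟨ε, hε, hu⟩ := Metric.mem_uniformity_dist.1 hu
  obtain ⟨L, -, hL⟩ := h C hC hK ε hε
  refine ⟨run σ L, (continuous_run σ hσ L).continuousOn, fun x hx => hu ?_⟩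
  rw [dist_comm]
  exact hL x hx

/-- Stacks approximating a composition of realizable maps can be taken with at least
two cells. -/
lemma exists_comp (h : Realizable σ S T) (h' : Realizable σ S' T') (hσ : Continuous σ)
    (hm : Set.MapsTo T S S') (C : Set (Sequence d N)) (hC : C ⊆ S) (hK : IsCompact C) (ε : ℝ)
    (hε : 0 < ε) : ∃ L : List (BRNNCell d), 2 ≤ L.length ∧
      ∀ x ∈ C, dist (run σ L x) (T' (T x)) < ε := by
  have hK' : IsCompact (T '' C) := hK.image_of_continuousOn (h.continuousOn hσ C hC hK)
  obtain ⟨L', hL', hd'⟩ := h' (T '' C) ((hm.mono_left hC).image_subset) hK' (ε / 2) (half_pos hε)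
  obtain ⟨δ, hδ, hcont⟩ := exists_dist_lt_of_continuous (run σ L') (continuous_run σ hσ L')
    (T '' C) hK' (ε / 2) (half_pos hε)
  obtain ⟨L, hL, hd⟩ := h C hC hK δ hδ
  refine ⟨L ++ L', ?_, fun x hx => ?_⟩
  · have h1 := List.length_pos_iff.2 hL
    have h2 := List.length_pos_iff.2 hL'
    rw [List.length_append]
    omega
  · rw [run_append]
    have h1 := hcont (T x) (Set.mem_image_of_mem T hx) _ (hd x hx)
    have h2 := hd' (T x) (Set.mem_image_of_mem T hx)
    have := dist_triangle (run σ L' (run σ L x)) (run σ L' (T x)) (T' (T x))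
    linarith

lemma comp (h : Realizable σ S T) (h' : Realizable σ S' T') (hσ : Continuous σ)
    (hm : Set.MapsTo T S S') : Realizable σ S (fun x => T' (T x)) := by
  intro C hC hK ε hε
  obtain ⟨L, hL, hd⟩ := h.exists_comp h' hσ hm C hC hK ε hε
  exact ⟨L, by rintro rfl; simp at hL, hd⟩

end Realizable

/-! ### Time reversal -/

/-- The sequence read backwards. -/
def reverse (x : Sequence d N) : Sequence d N := fun t => x t.rev

@[simp] lemma reverse_apply (x : Sequence d N) (t : Fin N) : reverse x t = x t.rev := rfl

@[simp] lemma reverse_reverse (x : Sequence d N) : reverse (reverse x) = x := by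
  funext t; simp

lemma continuous_reverse : Continuous (reverse (d := d) (N := N)) :=
  continuous_pi fun t => continuous_apply t.rev

lemma dist_reverse (x y : Sequence d N) : dist (reverse x) (reverse y) ≤ dist x y :=
  (dist_pi_le_iff dist_nonneg).2 fun t => dist_le_pi_dist x y t.rev

/-- The cell with both directions exchanged. -/
def BRNNCell.swap (C : BRNNCell d) : BRNNCell d := ⟨C.bwd, C.fwd, C.Wbar, C.W⟩

lemma BRNNCell.eval_swap (σ : ℝ → ℝ) (C : BRNNCell d) (x : Sequence d N) :
    C.swap.eval σ (reverse x) = reverse (C.eval σ x) := by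
  funext t
  have h : (fun s => reverse x (Fin.rev s)) = x := reverse_reverse x
  simp only [BRNNCell.eval, BRNNCell.swap, RNNCell.backward, reverse_apply, Fin.rev_rev]
  rw [add_comm]
  rfl

lemma run_map_swap (σ : ℝ → ℝ) (L : List (BRNNCell d)) (x : Sequence d N) :
    run σ (L.map BRNNCell.swap) (reverse x) = reverse (run σ L x) := by
  induction L generalizing x with
  | nil => rfl
  | cons C L ih => exact (congrArg _ (C.eval_swap σ x)).trans (ih (C.eval σ x))

lemma Realizable.reverse {σ : ℝ → ℝ} {S : Set (Sequence d N)} {T : Sequence d N → Sequence d N}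
    (h : Realizable σ S T) :
    Realizable σ (DeepBRNN.reverse ⁻¹' S) (fun x => DeepBRNN.reverse (T (DeepBRNN.reverse x))) := by
  intro C hC hK ε hε
  obtain ⟨L, hL, hd⟩ := h (DeepBRNN.reverse '' C) (Set.image_subset_iff.2 hC)
    (hK.image continuous_reverse) ε hε
  refine ⟨L.map BRNNCell.swap, by simpa using hL, fun x hx => ?_⟩
  have h1 := run_map_swap σ L (DeepBRNN.reverse x)
  rw [reverse_reverse] at h1
  rw [h1]
  exact (dist_reverse _ _).trans_lt (hd _ (Set.mem_image_of_mem _ hx))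

/-! ### Near-identity cells, ridge cells and recurrent cells -/

/-- The activation rescaled around `z₀`, which tends to the identity as `δ → 0` when
`s = σ'(z₀)`. -/
noncomputable def rescale (σ : ℝ → ℝ) (z₀ s δ z : ℝ) : ℝ := (δ * s)⁻¹ * (σ (δ * z + z₀) - σ z₀)

lemma abs_rescale_sub_lt (σ : ℝ → ℝ) (z₀ s : ℝ) (hs : s ≠ 0) (h : HasDerivAt σ s z₀) (R η : ℝ)
    (hη : 0 < η) :
    ∀ᶠ δ in 𝓝[>] (0 : ℝ), ∀ z, |z| ≤ R → |rescale σ z₀ s δ z - z| < η := by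
  set R' := max R 1
  have hR : 0 < R' := lt_of_lt_of_le one_pos (le_max_right _ _)
  have hs' : 0 < |s| := abs_pos.2 hs
  have h1 := hasDerivAt_iff_isLittleO_nhds_zero.1 h
  have h2 := h1.def (c := η * |s| / (2 * R')) (by positivity)
  obtain ⟨r, hr, hr'⟩ := Metric.eventually_nhds_iff.1 h2
  filter_upwards [Ioo_mem_nhdsGT (div_pos hr hR)] with δ hδ z hz
  have hδ0 : 0 < δ := hδ.1
  have hzR : |z| ≤ R' := hz.trans (le_max_left _ _)
  have hlt : δ * R' < r := (lt_div_iff₀ hR).1 hδ.2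
  have h3 : |δ * z| ≤ δ * R' := by
    rw [abs_mul, abs_of_pos hδ0]
    exact mul_le_mul_of_nonneg_left hzR hδ0.le
  have h4 := @hr' (δ * z) (by simpa using h3.trans_lt hlt)
  rw [Real.norm_eq_abs, Real.norm_eq_abs, smul_eq_mul, add_comm z₀] at h4
  have h5 : rescale σ z₀ s δ z - z
      = (δ * s)⁻¹ * (σ (δ * z + z₀) - σ z₀ - δ * z * s) := by
    rw [rescale]
    field_simp
  rw [h5, abs_mul, abs_inv, abs_mul, abs_of_pos hδ0]
  calc (δ * |s|)⁻¹ * |σ (δ * z + z₀) - σ z₀ - δ * z * s|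
      ≤ (δ * |s|)⁻¹ * (η * |s| / (2 * R') * (δ * R')) := by
        gcongr
        exact h4.trans (by gcongr)
    _ = η / 2 := by field_simp
    _ < η := half_lt_self hη

lemma exists_bound_of_isCompact (C : Set (Sequence d N)) (hC : IsCompact C) :
    ∃ R, 0 ≤ R ∧ ∀ x ∈ C, ∀ t i, |x t i| ≤ R := by
  obtain ⟨R, hR⟩ := hC.isBounded.exists_norm_le
  refine ⟨max R 0, le_max_right _ _, fun x hx t i => ?_⟩
  exact ((norm_le_pi_norm (x t) i).trans (norm_le_pi_norm x t)).trans
    ((hR x hx).trans (le_max_left _ _))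

/-- A cell without recurrence, computing approximately `x ↦ M x + σ(w · x + b) c`. -/
noncomputable def ridgeCell (z₀ s δ : ℝ) (k j : Fin d) (M : Matrix (Fin d) (Fin d) ℝ)
    (w : Fin d → ℝ) (b : ℝ) (c : Fin d → ℝ) : BRNNCell d where
  fwd := ⟨0, Matrix.diagonal fun _ => δ, fun _ => z₀⟩
  bwd := ⟨0, Matrix.of (Function.update 0 k w), Function.update (fun _ => z₀) k b⟩
  W := (δ * s)⁻¹ • M
  -- Neuron `k` of the backward cell carries the ridge function. Neuron `j` has no input and outputs
  -- `σ z₀`; its column subtracts the offset left by the rescaled forward neurons.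
  Wbar := Matrix.of fun i l =>
    (if l = k then c i else 0) + if l = j then -((δ * s)⁻¹ * ∑ l', M i l') else 0

lemma ridgeCell_eval (σ : ℝ → ℝ) (z₀ s δ : ℝ) (k j : Fin d) (hkj : j ≠ k)
    (M : Matrix (Fin d) (Fin d) ℝ) (w : Fin d → ℝ) (b : ℝ) (c : Fin d → ℝ) (x : Sequence d N)
    (t : Fin N) (i : Fin d) :
    (ridgeCell z₀ s δ k j M w b c).eval σ x t i
      = ∑ l, M i l * rescale σ z₀ s δ (x t l) + σ (w ⬝ᵥ x t + b) * c i := by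
  simp only [BRNNCell.eval, ridgeCell, RNNCell.backward, RNNCell.forward, RNNCell.state,
    Matrix.zero_mulVec, zero_add, Pi.add_apply, Matrix.diagonal_apply, Matrix.mulVec,
    dotProduct, Matrix.smul_apply, Matrix.of_apply, smul_eq_mul, add_mul, Finset.sum_add_distrib,
    ite_mul, zero_mul, Finset.sum_ite_eq', Finset.sum_ite_eq, Finset.mem_univ, if_true, Fin.rev_rev, Fin.eta]
  simp only [Function.update_self, Function.update_of_ne hkj, Pi.zero_apply, zero_mul,
    Finset.sum_const_zero, zero_add, rescale]
  simp only [Finset.mul_sum, Finset.sum_mul, mul_sub, Finset.sum_sub_distrib, neg_mul]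
  have e1 : ∀ l, (δ * s)⁻¹ * M i l * σ (δ * x t l + z₀) = M i l * ((δ * s)⁻¹ * σ (δ * x t l + z₀)) :=
    fun l => by ring
  have e2 : ∀ l, (δ * s)⁻¹ * M i l * σ z₀ = M i l * ((δ * s)⁻¹ * σ z₀) := fun l => by ring
  simp only [e1, e2]
  ring

lemma realizable_ridge (σ : ℝ → ℝ) (z₀ s : ℝ) (hs : s ≠ 0) (h : HasDerivAt σ s z₀)
    (k j : Fin d) (hkj : j ≠ k) (M : Matrix (Fin d) (Fin d) ℝ) (w : Fin d → ℝ) (b : ℝ)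
    (c : Fin d → ℝ) :
    Realizable (N := N) σ Set.univ (fun x t => M *ᵥ x t + σ (w ⬝ᵥ x t + b) • c) := by
  refine Realizable.of_cell fun C _ hK ε hε => ?_
  obtain ⟨R, -, hR⟩ := exists_bound_of_isCompact C hK
  set B := ∑ i, ∑ l, |M i l|
  have hB : 0 ≤ B := Finset.sum_nonneg fun i _ => Finset.sum_nonneg fun l _ => abs_nonneg _
  obtain ⟨δ, hδ⟩ := (abs_rescale_sub_lt σ z₀ s hs h R (ε / (B + 1)) (by positivity)).exists
  refine ⟨ridgeCell z₀ s δ k j M w b c, fun x hx => ?_⟩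
  refine (dist_pi_lt_iff hε).2 fun t => (dist_pi_lt_iff hε).2 fun i => ?_
  rw [ridgeCell_eval _ _ _ _ _ _ hkj, Real.dist_eq]
  simp only [Pi.add_apply, Pi.smul_apply, smul_eq_mul, Matrix.mulVec, dotProduct]
  rw [add_sub_add_right_eq_sub, ← Finset.sum_sub_distrib]
  calc |∑ l, (M i l * rescale σ z₀ s δ (x t l) - M i l * x t l)|
      ≤ ∑ l, |M i l| * (ε / (B + 1)) := by
        refine (Finset.abs_sum_le_sum_abs _ _).trans (Finset.sum_le_sum fun l _ => ?_)
        rw [← mul_sub, abs_mul]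
        exact mul_le_mul_of_nonneg_left (hδ _ (hR x hx t l)).le (abs_nonneg _)
    _ ≤ B * (ε / (B + 1)) := by
        rw [← Finset.sum_mul]
        gcongr
        exact Finset.single_le_sum (f := fun i => ∑ l, |M i l|)
          (fun i _ => Finset.sum_nonneg fun l _ => abs_nonneg _) (Finset.mem_univ i)
    _ < ε := by
        rw [← mul_div_assoc, div_lt_iff₀ (by positivity)]
        nlinarith

/-- A cell whose forward part has a recurrent neuron `k`, the other coordinates being
approximately preserved. -/
noncomputable def recurrentCell (z₀ s δ : ℝ) (k : Fin d) (a β b ω ω' : ℝ) :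
    BRNNCell d where
  fwd := ⟨Matrix.diagonal (Pi.single k a), Matrix.diagonal (Function.update (fun _ => δ) k β),
    Function.update (fun _ => z₀) k b⟩
  -- A constant cell with output `σ z₀`, used to cancel offsets.
  bwd := ⟨0, 0, fun _ => z₀⟩
  W := Matrix.diagonal (Function.update (fun _ => (δ * s)⁻¹) k ω)
  Wbar := Matrix.diagonal (Function.update (fun _ => -(δ * s)⁻¹) k ω')

lemma recurrentCell_eval_of_ne (σ : ℝ → ℝ) (z₀ s δ : ℝ) (k : Fin d) (a β b ω ω' : ℝ)
    (x : Sequence d N) (t : Fin N) (i : Fin d) (hi : i ≠ k) :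
    (recurrentCell z₀ s δ k a β b ω ω').eval σ x t i = rescale σ z₀ s δ (x t i) := by
  simp [BRNNCell.eval, recurrentCell, RNNCell.backward, RNNCell.forward, RNNCell.state,
    Matrix.mulVec_diagonal, hi, rescale]
  ring

lemma recurrentCell_eval_self (σ : ℝ → ℝ) (z₀ s δ : ℝ) (k : Fin d) (a β b ω ω' : ℝ)
    (x : Sequence d N) (t : Fin N) :
    (recurrentCell z₀ s δ k a β b ω ω').eval σ x t k
      = ω * (recurrentCell z₀ s δ k a β b ω ω').fwd.state σ x (t + 1) t.isLt k + ω' * σ z₀ := by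
  simp [BRNNCell.eval, recurrentCell, RNNCell.backward, RNNCell.forward, RNNCell.state,
    Matrix.mulVec_diagonal]

lemma recurrentCell_state_succ (σ : ℝ → ℝ) (z₀ s δ : ℝ) (k : Fin d) (a β b ω ω' : ℝ)
    (x : Sequence d N) (t : ℕ) (ht : t + 1 ≤ N) :
    (recurrentCell z₀ s δ k a β b ω ω').fwd.state σ x (t + 1) ht k
      = σ (a * (recurrentCell z₀ s δ k a β b ω ω').fwd.state σ x t (Nat.le_of_succ_le ht) k
          + β * x ⟨t, ht⟩ k + b) := by
  conv_lhs => rw [RNNCell.state]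
  simp [recurrentCell, Matrix.mulVec_diagonal]

/-- The orbit of `0` under `z ↦ σ (a * z + b)`. -/
def orbit (σ : ℝ → ℝ) (a b : ℝ) : ℕ → ℝ
  | 0 => 0
  | n + 1 => σ (a * orbit σ a b n + b)

/-- Near `z₀` the function is injective, so it is nonzero at some nearby `b`. For small `a > 0` all
arguments `a * z + b` along the orbit stay in the injectivity region and all later terms stay away
from `0`. An equality of two terms could be pulled back step by step to `0` equalling a later term.
-/
lemma exists_injective_orbit (σ : ℝ → ℝ) (z₀ s : ℝ) (hs : s ≠ 0) (h : HasStrictDerivAt σ s z₀)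
    (hσ : Continuous σ) : ∃ a b, Function.Injective (orbit σ a b) := by
  obtain ⟨U, hU, hinj⟩ : ∃ U ∈ 𝓝 z₀, Set.InjOn σ U := by
    have h' := h.hasStrictFDerivAt_equiv hs
    refine ⟨h'.toOpenPartialHomeomorph.source,
      h'.toOpenPartialHomeomorph.open_source.mem_nhds h'.mem_toOpenPartialHomeomorph_source, ?_⟩
    exact h'.toOpenPartialHomeomorph.injOn
  obtain ⟨r, hr, hrU⟩ := Metric.mem_nhds_iff.1 hU
  obtain ⟨b, hb, hb0⟩ : ∃ b ∈ Metric.ball z₀ r, σ b ≠ 0 := by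
    by_contra! hcon
    have h1 : z₀ ∈ Metric.ball z₀ r := Metric.mem_ball_self hr
    have h2 : z₀ + r / 2 ∈ Metric.ball z₀ r := by
      rw [Metric.mem_ball, Real.dist_eq, add_sub_cancel_left, abs_of_pos (by positivity)]
      exact half_lt_self hr
    have := hinj (hrU h1) (hrU h2) ((hcon _ h1).trans (hcon _ h2).symm)
    linarith
  have hm : 0 < |σ b| := abs_pos.2 hb0
  have hev : ∀ᶠ z in 𝓝 b, z ∈ U ∧ |σ z - σ b| < |σ b| / 2 := by
    refine Filter.Eventually.and ?_ ?_
    · exact Filter.mem_of_superset (Metric.isOpen_ball.mem_nhds hb) hrU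
    · exact (Metric.tendsto_nhds.1 hσ.continuousAt) _ (half_pos hm)
  obtain ⟨q, hq, hqU⟩ := Metric.eventually_nhds_iff.1 hev
  set a := q / (2 * |σ b| + 1)
  have ha : 0 < a := by positivity
  have key : ∀ z, |z| ≤ 2 * |σ b| → a * z + b ∈ U ∧ |σ (a * z + b) - σ b| < |σ b| / 2 := by
    intro z hz
    apply hqU
    rw [Real.dist_eq, add_sub_cancel_right, abs_mul, abs_of_pos ha]
    calc a * |z| ≤ a * (2 * |σ b|) := by gcongr
      _ < a * (2 * |σ b| + 1) := by gcongr; linarith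
      _ = q := div_mul_cancel₀ _ (by positivity)
  have hbound : ∀ n, |orbit σ a b n| ≤ 2 * |σ b| := by
    intro n
    induction n with
    | zero => simp [orbit]
    | succ n ih =>
      have h1 := (key _ ih).2
      have h2 := abs_sub_abs_le_abs_sub (σ (a * orbit σ a b n + b)) (σ b)
      rw [orbit]
      linarith
  have hne : ∀ n, orbit σ a b (n + 1) ≠ 0 := by
    intro n h0
    have h1 := (key _ (hbound n)).2
    rw [orbit] at h0
    rw [h0, zero_sub, abs_neg] at h1
    linarith
  have hlt : ∀ i j, i < j → orbit σ a b i ≠ orbit σ a b j := by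
    intro i
    induction i with
    | zero =>
      intro j hj
      obtain ⟨j, rfl⟩ := Nat.exists_eq_succ_of_ne_zero hj.ne'
      exact (hne j).symm
    | succ i ih =>
      intro j hj heq
      obtain ⟨j, rfl⟩ := Nat.exists_eq_succ_of_ne_zero (Nat.ne_zero_of_lt hj)
      have h1 := hinj (key _ (hbound i)).1 (key _ (hbound j)).1 heq
      exact ih j (Nat.lt_of_succ_lt_succ hj) (mul_left_cancel₀ ha.ne' (add_right_cancel h1))
  refine ⟨a, b, fun i j hij => ?_⟩
  rcases lt_trichotomy i j with h1 | h1 | h1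
  · exact absurd hij (hlt i j h1)
  · exact h1
  · exact absurd hij.symm (hlt j i h1)

/-- The positions of the tokens can be written into a coordinate. -/
lemma realizable_clock (σ : ℝ → ℝ) (z₀ s : ℝ) (hs : s ≠ 0) (h : HasStrictDerivAt σ s z₀)
    (hσ : Continuous σ) (k : Fin d) : ∃ r : Fin N → ℝ, Function.Injective r ∧
      Realizable σ Set.univ (fun (x : Sequence d N) t => Function.update (x t) k (r t)) := by
  obtain ⟨a, b, hab⟩ := exists_injective_orbit σ z₀ s hs h hσ
  refine ⟨fun t => orbit σ a b (t + 1), fun t t' ht => Fin.ext (Nat.succ_injective (hab ht)), ?_⟩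
  refine Realizable.of_cell fun C _ hK ε hε => ?_
  obtain ⟨R, -, hR⟩ := exists_bound_of_isCompact C hK
  obtain ⟨δ, hδ⟩ := (abs_rescale_sub_lt σ z₀ s hs h.hasDerivAt R ε hε).exists
  refine ⟨recurrentCell z₀ s δ k a 0 b 1 0, fun x hx => ?_⟩
  refine (dist_pi_lt_iff hε).2 fun t => (dist_pi_lt_iff hε).2 fun i => ?_
  rw [Real.dist_eq]
  by_cases hi : i = k
  · subst hi
    have hst : ∀ n (hn : n ≤ N),
        (recurrentCell z₀ s δ i a 0 b 1 0).fwd.state σ x n hn i = orbit σ a b n := by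
      intro n
      induction n with
      | zero => intro _; rfl
      | succ n ih => intro hn; simp [recurrentCell_state_succ, ih, orbit]
    rw [recurrentCell_eval_self, hst]
    simpa
  · rw [recurrentCell_eval_of_ne _ _ _ _ _ _ _ _ _ _ _ _ _ hi, Function.update_of_ne hi]
    exact hδ _ (hR x hx t i)

/-- The recursion `y ↦ ψ (y + u n)` started at `0`. -/
def accumulate (ψ : ℝ → ℝ) (u : ℕ → ℝ) : ℕ → ℝ
  | 0 => 0
  | n + 1 => ψ (accumulate ψ u n + u n)

lemma abs_accumulate_rescale_sub_lt (σ : ℝ → ℝ) (z₀ s : ℝ) (hs : s ≠ 0) (h : HasDerivAt σ s z₀)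
    (R : ℝ) (n : ℕ) : ∀ η > 0, ∀ᶠ δ in 𝓝[>] (0 : ℝ), ∀ u : ℕ → ℝ, (∀ m, |u m| ≤ R) →
      |accumulate (rescale σ z₀ s δ) u n - ∑ m ∈ Finset.range n, u m| < η := by
  induction n with
  | zero => intro η hη; filter_upwards with δ u _; simpa [accumulate]
  | succ n ih =>
    intro η hη
    -- The bound `1` keeps the next argument within `n * R + 1 + R`, where the rescaled activation
    -- is close to the identity; `η / 2` is the inherited share of the error.
    filter_upwards [ih (min 1 (η / 2)) (by positivity),
      abs_rescale_sub_lt σ z₀ s hs h (n * R + 1 + R) (η / 2) (by positivity)] with δ h1 h2 u hu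
    have h3 := h1 u hu
    have h4 : |∑ m ∈ Finset.range n, u m| ≤ n * R := by
      refine (Finset.abs_sum_le_sum_abs _ _).trans ?_
      exact (Finset.sum_le_sum fun m _ => hu m).trans (by simp)
    have h5 := h3.trans_le (min_le_left _ _)
    have h6 := h3.trans_le (min_le_right _ _)
    have h7 := hu n
    rw [abs_lt] at h5 h6
    rw [abs_le] at h4 h7
    have h8 := h2 (accumulate (rescale σ z₀ s δ) u n + u n) (abs_le.2 ⟨by linarith, by linarith⟩)
    rw [abs_lt] at h8 ⊢
    rw [Finset.sum_range_succ, accumulate]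
    constructor <;> linarith

/-! ### Continuous token-wise updates, position dependence and partial sums -/

lemma realizable_eval (σ : ℝ → ℝ) (c : BRNNCell d) :
    Realizable (N := N) σ Set.univ (c.eval σ) :=
  Realizable.of_cell fun _ _ _ ε hε => ⟨c, fun x _ => by simpa using hε⟩

lemma IsNondegenerate.exists_hasStrictDerivAt {σ : ℝ → ℝ} (hσ : IsNondegenerate σ) :
    ∃ z₀ s, s ≠ 0 ∧ HasStrictDerivAt σ s z₀ := by
  obtain ⟨-, -, z₀, hd, hc, hs⟩ := hσ
  exact ⟨z₀, deriv σ z₀, hs,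
    hasStrictDerivAt_of_hasDerivAt_of_continuousAt (hd.mono fun z hz => hz.hasDerivAt) hc⟩

lemma IsNondegenerate.continuous {σ : ℝ → ℝ} (hσ : IsNondegenerate σ) : Continuous σ := hσ.1

lemma realizable_mulVec {σ : ℝ → ℝ} (hσ : IsNondegenerate σ) {k j : Fin d} (hkj : k ≠ j)
    (M : Matrix (Fin d) (Fin d) ℝ) :
    Realizable (N := N) σ Set.univ (fun x t => M *ᵥ x t) := by
  obtain ⟨z₀, s, hs, h⟩ := hσ.exists_hasStrictDerivAt
  simpa using realizable_ridge (N := N) σ z₀ s hs h.hasDerivAt k j hkj.symm M 0 0 0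

/-- One cell adds one ridge term. As register `k` is zeroed before `g` reads the token, earlier
additions do not disturb later ones, and sums become compositions. -/
lemma realizable_add_ridgeSpan {σ : ℝ → ℝ} (hσ : IsNondegenerate σ) {k j : Fin d} (hkj : k ≠ j)
    (g : (Fin d → ℝ) → ℝ) (hg : g ∈ ridgeSpan (Fin d → ℝ) σ) : ∀ c : ℝ,
    Realizable (N := N) σ Set.univ
      (fun x t => x t + Pi.single k (c * g (Function.update (x t) k 0))) := by
  obtain ⟨z₀, s, hs, h⟩ := hσ.exists_hasStrictDerivAt
  induction hg using Submodule.span_induction with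
  | mem g hg =>
    obtain ⟨⟨l, b⟩, rfl⟩ := hg
    intro c
    obtain ⟨w, hl⟩ : ∃ w : Fin d → ℝ, ∀ y, l (Function.update y k 0) = w ⬝ᵥ y := by
      refine ⟨fun i => if i = k then 0 else l fun m => if i = m then 1 else 0, fun y => ?_⟩
      have h1 := LinearMap.pi_apply_eq_sum_univ (l : (Fin d → ℝ) →ₗ[ℝ] ℝ) (Function.update y k 0)
      simp only [ContinuousLinearMap.coe_coe] at h1
      rw [h1, dotProduct]
      refine Finset.sum_congr rfl fun i _ => ?_
      by_cases hi : i = k <;> simp [hi, mul_comm]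
    refine (realizable_ridge (N := N) σ z₀ s hs h.hasDerivAt k j hkj.symm 1 w b
      (Pi.single k c)).congr fun x _ => ?_
    funext t
    simp only [hl, Matrix.one_mulVec, ← Pi.single_smul, smul_eq_mul, mul_comm]
  | zero => intro c; simpa using realizable_mulVec hσ hkj 1
  | add p q _ _ hp hq =>
    intro c
    refine ((hp c).comp (hq c) hσ.continuous (Set.mapsTo_univ _ _)).congr fun x _ => ?_
    funext t
    have : Function.update (x t + Pi.single k (c * p (Function.update (x t) k 0))) k 0
        = Function.update (x t) k 0 := by
      ext i
      by_cases hi : i = k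
      · subst hi; simp
      · simp [hi]
    rw [this, add_assoc, ← Pi.single_add, Pi.add_apply, mul_add]
  | smul a q _ hq =>
    intro c
    refine (hq (c * a)).congr fun x _ => ?_
    simp [mul_assoc]

/-- A continuous function of the other coordinates of a token can be added to a coordinate. -/
lemma realizable_add {σ : ℝ → ℝ} (hσ : IsNondegenerate σ) {k j : Fin d} (hkj : k ≠ j)
    (g : (Fin d → ℝ) → ℝ) (hg : Continuous g)
    (hk : ∀ y a, g (Function.update y k a) = g y) :
    Realizable (N := N) σ Set.univ (fun x t => x t + Pi.single k (g (x t))) := by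
  refine Realizable.of_limit fun C _ hC ε hε => ?_
  obtain ⟨R, hR0, hR⟩ := exists_bound_of_isCompact C hC
  obtain ⟨q, hq, hqg⟩ := isCompactLimit_ridgeSpan σ hσ.1 hσ.2.1 g hg
    (Metric.closedBall 0 R) (isCompact_closedBall 0 R) ε hε
  refine ⟨_, realizable_add_ridgeSpan hσ hkj q hq 1, fun x hx => ?_⟩
  refine (dist_pi_lt_iff hε).2 fun t => (dist_pi_lt_iff hε).2 fun i => ?_
  rw [Pi.add_apply, Pi.add_apply, dist_add_left, Real.dist_eq]
  by_cases hi : i = k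
  · subst hi
    rw [Pi.single_eq_same, Pi.single_eq_same, one_mul, abs_sub_comm, ← hk (x t) 0]
    refine hqg _ ?_
    rw [mem_closedBall_zero_iff, pi_norm_le_iff_of_nonneg hR0]
    intro l
    by_cases hl : l = i
    · subst hl; simpa using hR0
    · simpa [hl] using hR x hx t l
  · simpa [hi] using hε

/-- The sequences whose coordinate `τ` contains the values `r`. -/
def clockSet (τ : Fin d) (r : Fin N → ℝ) : Set (Sequence d N) := {x | ∀ t, x t τ = r t}

/-- When the positions are stored in a coordinate, the function added to a coordinate may depend
on the position. -/
lemma realizable_add_clock {σ : ℝ → ℝ} (hσ : IsNondegenerate σ) {k τ : Fin d} (hk : k ≠ τ)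
    (r : Fin N → ℝ) (hr : Function.Injective r) (g : Fin N → (Fin d → ℝ) → ℝ)
    (hg : ∀ t, Continuous (g t)) (hgk : ∀ t y a, g t (Function.update y k a) = g t y) :
    Realizable σ (clockSet τ r) (fun x t => x t + Pi.single k (g t (x t))) := by
  refine ((realizable_add (N := N) hσ hk
    -- At a clock value, the Lagrange basis polynomials are the indicators of the positions.
    (fun y => ∑ t, (Lagrange.basis Finset.univ r t).eval (y τ) * g t y) ?_ ?_).mono
      (Set.subset_univ _)).congr fun x hx => ?_
  · exact continuous_finsetSum _ fun t _ =>
      ((Polynomial.continuous _).comp (continuous_apply τ)).mul (hg t)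
  · intro y a
    simp only [hgk, Function.update_of_ne hk.symm]
  · funext t
    rw [hx t, Finset.sum_eq_single t]
    · rw [Lagrange.eval_basis_self hr.injOn (Finset.mem_univ t), one_mul]
    · intro i _ hi
      rw [Lagrange.eval_basis_of_ne hi (Finset.mem_univ t), zero_mul]
    · simp

/-- The hidden state stores the accumulator `y` as `σ z₀ + δ * s * y`; the slope `s⁻¹` and the bias
`z₀ - σ z₀ / s` undo this encoding before each step. The initial state `0` does not encode `y = 0`,
and the extra `σ z₀ / (δ * s)` in the first token repairs this. -/
lemma recurrentCell_state_eq_accumulate (σ : ℝ → ℝ) (z₀ s δ : ℝ) (hs : s ≠ 0) (hδ : δ ≠ 0)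
    (k : Fin d) (ω ω' : ℝ) (x x' : Sequence d N) (u : ℕ → ℝ)
    (hu : ∀ t : Fin N, u t = x t k)
    (hx' : ∀ t : Fin N, x' t k = x t k + if (t : ℕ) = 0 then σ z₀ / (δ * s) else 0) :
    ∀ n (hn : n + 1 ≤ N),
      (recurrentCell z₀ s δ k s⁻¹ δ (z₀ - σ z₀ / s) ω ω').fwd.state σ x' (n + 1) hn k
        = σ z₀ + δ * s * accumulate (rescale σ z₀ s δ) u (n + 1) := by
  intro n
  induction n with
  | zero =>
    intro hn
    rw [recurrentCell_state_succ, hx', ← hu]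
    simp only [accumulate, rescale, RNNCell.state, Pi.zero_apply, if_true, zero_add, mul_zero]
    rw [mul_inv_cancel_left₀ (mul_ne_zero hδ hs), add_sub_cancel]
    congr 1
    field_simp
    ring
  | succ n ih =>
    intro hn
    have hacc : accumulate (rescale σ z₀ s δ) u (n + 1 + 1)
        = rescale σ z₀ s δ (accumulate (rescale σ z₀ s δ) u (n + 1) + u (n + 1)) := rfl
    rw [recurrentCell_state_succ, ih, hx', ← hu, hacc, rescale,
      mul_inv_cancel_left₀ (mul_ne_zero hδ hs), add_sub_cancel]
    simp only [Nat.add_eq_zero_iff, one_ne_zero, and_false, if_false]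
    congr 1
    field_simp
    ring

/-- The partial sums of a coordinate can be computed. -/
lemma realizable_cumsum {σ : ℝ → ℝ} (hσ : IsNondegenerate σ) {k τ : Fin d} (hk : k ≠ τ)
    (r : Fin N → ℝ) (hr : Function.Injective r) :
    Realizable σ (clockSet τ r)
      (fun x t => Function.update (x t) k (∑ i, if i ≤ t then x i k else 0)) := by
  obtain ⟨z₀, s, hs, h⟩ := hσ.exists_hasStrictDerivAt
  refine Realizable.of_limit fun C _ hC ε hε => ?_
  obtain ⟨R, hR0, hR⟩ := exists_bound_of_isCompact C hC
  have hev := ((Filter.eventually_all (l := 𝓝[>] (0 : ℝ))).2 fun t : Fin N =>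
    abs_accumulate_rescale_sub_lt σ z₀ s hs h.hasDerivAt R (t + 1) ε hε).and
    ((abs_rescale_sub_lt σ z₀ s hs h.hasDerivAt R ε hε).and self_mem_nhdsWithin)
  obtain ⟨δ, hacc, hresc, hδ⟩ := hev.exists
  have hδ0 : δ ≠ 0 := (Set.mem_Ioi.1 hδ).ne'
  -- The correction grows as `δ → 0`, but it is approximated only after `δ` has been fixed.
  have hcorr := realizable_add_clock hσ hk r hr
    (fun t _ => if (t : ℕ) = 0 then σ z₀ / (δ * s) else 0) (fun _ => continuous_const)
    (fun _ _ _ => rfl)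
  refine ⟨_, hcorr.comp (realizable_eval σ (recurrentCell z₀ s δ k s⁻¹ δ (z₀ - σ z₀ / s)
    (δ * s)⁻¹ (-(δ * s)⁻¹))) hσ.continuous (Set.mapsTo_univ _ _), fun x hx => ?_⟩
  refine (dist_pi_lt_iff hε).2 fun t => (dist_pi_lt_iff hε).2 fun i => ?_
  rw [Real.dist_eq]
  by_cases hi : i = k
  · subst hi
    set u : ℕ → ℝ := fun m => if hm : m < N then x ⟨m, hm⟩ i else 0 with hu
    have huR : ∀ m, |u m| ≤ R := by
      intro m
      simp only [hu]
      split_ifs with hm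
      · exact hR x hx _ _
      · simpa using hR0
    rw [recurrentCell_eval_self, recurrentCell_state_eq_accumulate σ z₀ s δ hs hδ0 i _ _ x _ u
      (fun t => by simp [hu]) (fun t => by simp)]
    have hsum : ∑ m ∈ Finset.range (t + 1), u m = ∑ l : Fin N, if l ≤ t then x l i else 0 := by
      have h1 : ∀ l : Fin N, (if l ≤ t then x l i else 0)
          = (fun m : ℕ => if m ≤ (t : ℕ) then u m else 0) (l : ℕ) := by
        intro l
        simp [hu]
      simp only [h1]
      rw [Fin.sum_univ_eq_sum_range (fun m : ℕ => if m ≤ (t : ℕ) then u m else 0) N,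
        ← Finset.sum_filter]
      congr 1
      ext m
      simp only [Finset.mem_range, Finset.mem_filter]
      have := t.isLt
      omega
    have h2 := hacc t u huR
    rw [hsum] at h2
    rw [Function.update_self]
    convert h2 using 2
    field_simp
    ring
  · rw [recurrentCell_eval_of_ne _ _ _ _ _ _ _ _ _ _ _ _ _ hi, Function.update_of_ne hi]
    simpa [hi] using hresc _ (hR x hx t i)

lemma realizable_cumsum_reverse {σ : ℝ → ℝ} (hσ : IsNondegenerate σ) {k τ : Fin d} (hk : k ≠ τ)
    (r : Fin N → ℝ) (hr : Function.Injective r) :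
    Realizable σ (clockSet τ r)
      (fun x t => Function.update (x t) k (∑ i, if t ≤ i then x i k else 0)) := by
  refine ((realizable_cumsum hσ hk (fun t => r t.rev)
    (hr.comp Fin.rev_injective)).reverse.mono ?_).congr ?_
  · intro x hx t
    exact hx t.rev
  · intro x _
    funext t
    simp only [reverse_apply, Fin.rev_rev]
    congr 1
    rw [← Equiv.sum_comp Fin.revPerm]
    simp [Fin.rev_le_rev]

/-! ### Register programs computing functions of the whole sequence -/

variable {dx dy : ℕ}

/-- An assignment of coordinates to the input, the output, the clock and two work registers. -/
abbrev Registers (d dx dy : ℕ) : Type := Fin dx ⊕ Fin dy ⊕ Fin 3 ↪ Fin d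

namespace Registers

variable (e : Registers d dx dy)

/-- The coordinates holding the input. -/
abbrev inp (i : Fin dx) : Fin d := e (Sum.inl i)

/-- The coordinates holding the output. -/
abbrev out (k : Fin dy) : Fin d := e (Sum.inr (Sum.inl k))

/-- The clock and the two work coordinates. -/
abbrev aux (j : Fin 3) : Fin d := e (Sum.inr (Sum.inr j))

end Registers

/-- `F` of the input registers can be added to the output registers, in presence of a clock. -/
def Computes (σ : ℝ → ℝ) (e : Registers d dx dy) (r : Fin N → ℝ)
    (F : Sequence dx N → Sequence dy N) : Prop :=
  ∃ T, Realizable σ (clockSet (e.aux 0) r) T ∧ ∀ x ∈ clockSet (e.aux 0) r,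
    T x ∈ clockSet (e.aux 0) r ∧ (∀ t i, T x t (e.inp i) = x t (e.inp i)) ∧
    ∀ t k, T x t (e.out k) = x t (e.out k) + F (fun t i => x t (e.inp i)) t k

lemma Computes.zero {σ : ℝ → ℝ} (hσ : IsNondegenerate σ) (e : Registers d dx dy) (r : Fin N → ℝ) :
    Computes σ e r 0 := by
  have h01 : e.aux 0 ≠ e.aux 1 := e.injective.ne (by simp)
  refine ⟨_, (realizable_mulVec hσ h01 1).mono (Set.subset_univ _), fun x hx => ⟨?_, ?_, ?_⟩⟩
  · simpa using hx
  · simp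
  · simp

/-- The first program leaves clock and inputs intact, so the second one sees the same input. -/
lemma Computes.add {σ : ℝ → ℝ} (hσ : IsNondegenerate σ) {e : Registers d dx dy} {r : Fin N → ℝ}
    {F G : Sequence dx N → Sequence dy N} (hF : Computes σ e r F) (hG : Computes σ e r G) :
    Computes σ e r (F + G) := by
  obtain ⟨T, hT, h⟩ := hF
  obtain ⟨T', hT', h'⟩ := hG
  refine ⟨_, hT.comp hT' hσ.continuous fun x hx => (h x hx).1, fun x hx => ?_⟩
  obtain ⟨h1, h2, h3⟩ := h x hx
  obtain ⟨h1', h2', h3'⟩ := h' _ h1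
  refine ⟨h1', fun t i => (h2' t i).trans (h2 t i), fun t k => ?_⟩
  rw [h3', h3]
  simp only [h2, Pi.add_apply, add_assoc]

lemma Computes.sum {σ : ℝ → ℝ} (hσ : IsNondegenerate σ) {e : Registers d dx dy} {r : Fin N → ℝ}
    {ι : Type*} (s : Finset ι) (F : ι → Sequence dx N → Sequence dy N)
    (hF : ∀ i ∈ s, Computes σ e r (F i)) : Computes σ e r (∑ i ∈ s, F i) :=
  Finset.sum_induction F _ (fun _ _ => Computes.add hσ) (Computes.zero hσ e r) hF

/-- A continuous function of a linear functional of the whole sequence can be added to a single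
output entry. -/
lemma computes_ridge {σ : ℝ → ℝ} (hσ : IsNondegenerate σ) (e : Registers d dx dy) (r : Fin N → ℝ)
    (hr : Function.Injective r) (t₀ : Fin N) (k₀ : Fin dy) (l : Sequence dx N →L[ℝ] ℝ) (φ : ℝ → ℝ)
    (hφ : Continuous φ) :
    Computes σ e r (fun x => Pi.single t₀ (Pi.single k₀ (φ (l x)))) := by
  obtain ⟨u, hu⟩ : ∃ u, u = e.aux 1 := ⟨_, rfl⟩
  obtain ⟨v, hv⟩ : ∃ v, v = e.aux 2 := ⟨_, rfl⟩
  obtain ⟨τ, hτ⟩ : ∃ τ, τ = e.aux 0 := ⟨_, rfl⟩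
  have huτ : u ≠ τ := by subst hu hτ; exact e.injective.ne (by simp)
  have hvτ : v ≠ τ := by subst hv hτ; exact e.injective.ne (by simp)
  have huv : u ≠ v := by subst hv hu; exact e.injective.ne (by simp)
  have hτo : τ ≠ e.out k₀ := by subst hτ; exact e.injective.ne (by simp)
  have hvo : v ≠ e.out k₀ := by subst hv; exact e.injective.ne (by simp)
  have hui : ∀ i, e.inp i ≠ u := fun i => by subst hu; exact e.injective.ne (by simp)
  have hvi : ∀ i, e.inp i ≠ v := fun i => by subst hv; exact e.injective.ne (by simp)
  have huo : ∀ i, e.out i ≠ u := fun i => by subst hu; exact e.injective.ne (by simp)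
  have hvo' : ∀ i, e.out i ≠ v := fun i => by subst hv; exact e.injective.ne (by simp)
  have hio : ∀ i, e.inp i ≠ e.out k₀ := fun i => e.injective.ne (by simp)
  have hlast : N - 1 < N := Nat.sub_lt (Fin.pos t₀) one_pos
  let last : Fin N := ⟨N - 1, hlast⟩
  have hle : ∀ t : Fin N, t ≤ last := fun t => Nat.le_sub_one_of_lt t.isLt
  let C : Set (Sequence d N) := clockSet τ r
  let inp : (Fin d → ℝ) → Fin dx → ℝ := fun y i => y (e.inp i)
  -- Clears both work registers, which may hold leftovers of an earlier program.
  let T₁ : Sequence d N → Sequence d N := fun x t =>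
    Matrix.diagonal (fun i => if i = u ∨ i = v then (0 : ℝ) else 1) *ᵥ x t
  let T₂ : Sequence d N → Sequence d N := fun x t =>
    x t + Pi.single u (l (Pi.single t (inp (x t))))
  let T₃ : Sequence d N → Sequence d N := fun x t =>
    Function.update (x t) u (∑ i, if i ≤ t then x i u else 0)
  -- Only the last token holds the complete sum; masking the others makes the backward sum in `T₅` a
  -- broadcast.
  let T₄ : Sequence d N → Sequence d N := fun x t =>
    x t + Pi.single v (if t = last then x t u else 0)
  let T₅ : Sequence d N → Sequence d N := fun x t =>
    Function.update (x t) v (∑ i, if t ≤ i then x i v else 0)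
  let T₆ : Sequence d N → Sequence d N := fun x t =>
    x t + Pi.single (e.out k₀) (if t = t₀ then φ (x t v) else 0)
  have p₁ : ∀ x t i, i ≠ u → i ≠ v → T₁ x t i = x t i := fun x t i h h' => by
    simp [T₁, Matrix.mulVec_diagonal, h, h']
  have p₂ : ∀ x t i, i ≠ u → T₂ x t i = x t i := fun x t i h => by simp [T₂, h]
  have p₃ : ∀ x t i, i ≠ u → T₃ x t i = x t i := fun x t i h => by simp [T₃, h]
  have p₄ : ∀ x t i, i ≠ v → T₄ x t i = x t i := fun x t i h => by simp [T₄, h]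
  have p₅ : ∀ x t i, i ≠ v → T₅ x t i = x t i := fun x t i h => by simp [T₅, h]
  have p₆ : ∀ x t i, i ≠ e.out k₀ → T₆ x t i = x t i := fun x t i h => by simp [T₆, h]
  have m₁ : Set.MapsTo T₁ C C := fun x hx t => (p₁ x t τ huτ.symm hvτ.symm).trans (hx t)
  have m₂ : Set.MapsTo T₂ C C := fun x hx t => (p₂ x t τ huτ.symm).trans (hx t)
  have m₃ : Set.MapsTo T₃ C C := fun x hx t => (p₃ x t τ huτ.symm).trans (hx t)
  have m₄ : Set.MapsTo T₄ C C := fun x hx t => (p₄ x t τ hvτ.symm).trans (hx t)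
  have m₅ : Set.MapsTo T₅ C C := fun x hx t => (p₅ x t τ hvτ.symm).trans (hx t)
  have m₆ : Set.MapsTo T₆ C C := fun x hx t => (p₆ x t τ hτo).trans (hx t)
  have r₁ : Realizable σ C T₁ := (realizable_mulVec hσ huτ _).mono (Set.subset_univ _)
  have r₂ : Realizable σ C T₂ := by
    refine realizable_add_clock hσ huτ r hr (fun t y => l (Pi.single t (inp y))) ?_ ?_
    · intro t
      refine l.continuous.comp ((continuous_single t).comp (continuous_pi fun i => ?_))
      exact continuous_apply _
    · intro t y a
      simp [inp, Function.update_of_ne (hui _)]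
  have r₃ : Realizable σ C T₃ := realizable_cumsum hσ huτ r hr
  have r₄ : Realizable σ C T₄ := by
    refine realizable_add_clock hσ hvτ r hr (fun t y => if t = last then y u else 0) ?_ ?_
    · intro t
      split_ifs
      · exact continuous_apply u
      · exact continuous_const
    · intro t y a
      simp [Function.update_of_ne huv]
  have r₅ : Realizable σ C T₅ := realizable_cumsum_reverse hσ hvτ r hr
  have r₆ : Realizable σ C T₆ := by
    refine realizable_add_clock hσ hτo.symm r hr (fun t y => if t = t₀ then φ (y v) else 0) ?_ ?_
    · intro t
      split_ifs
      · exact hφ.comp (continuous_apply v)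
      · exact continuous_const
    · intro t y a
      simp [Function.update_of_ne hvo]
  have hc := hσ.continuous
  have key := ((((r₁.comp r₂ hc m₁).comp r₃ hc (m₂.comp m₁)).comp r₄ hc
    (m₃.comp (m₂.comp m₁))).comp r₅ hc (m₄.comp (m₃.comp (m₂.comp m₁)))).comp r₆ hc
    (m₅.comp (m₄.comp (m₃.comp (m₂.comp m₁))))
  subst hτ
  refine ⟨_, key, fun x hx => ⟨m₆ (m₅ (m₄ (m₃ (m₂ (m₁ hx))))), fun t i => ?_, fun t k => ?_⟩⟩
  · rw [p₆ _ _ _ (hio i), p₅ _ _ _ (hvi i), p₄ _ _ _ (hvi i), p₃ _ _ _ (hui i),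
      p₂ _ _ _ (hui i), p₁ _ _ _ (hui i) (hvi i)]
  · have q₂ : ∀ t, T₂ (T₁ x) t u = l (Pi.single t fun i => x t (e.inp i)) := by
      intro t
      have : inp (T₁ x t) = fun i => x t (e.inp i) :=
        funext fun i => p₁ x t _ (hui i) (hvi i)
      have h0 : T₁ x t u = 0 := by simp [T₁, Matrix.mulVec_diagonal]
      simp only [T₂, Pi.add_apply, Pi.single_eq_same, this]
      rw [h0, zero_add]
    have q₃ : T₃ (T₂ (T₁ x)) last u = l fun t i => x t (e.inp i) := by
      simp only [T₃, Function.update_self, hle, if_true, q₂]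
      rw [← map_sum, Finset.univ_sum_single]
    have q₄ : ∀ t, T₄ (T₃ (T₂ (T₁ x))) t v
        = if t = last then l fun t i => x t (e.inp i) else 0 := by
      intro t
      have h0 : T₃ (T₂ (T₁ x)) t v = 0 := by
        rw [p₃ _ _ _ huv.symm, p₂ _ _ _ huv.symm]
        simp [T₁, Matrix.mulVec_diagonal]
      simp only [T₄, Pi.add_apply, Pi.single_eq_same]
      rw [h0, zero_add]
      split_ifs with ht
      · rw [ht, q₃]
      · rfl
    have q₅ : ∀ t, T₅ (T₄ (T₃ (T₂ (T₁ x)))) t v = l fun t i => x t (e.inp i) := by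
      intro t
      simp only [T₅, Function.update_self, q₄]
      rw [Finset.sum_eq_single last]
      · simp [hle]
      · intro i _ hi
        simp [hi]
      · simp
    have q₆ : ∀ y t, T₆ y t (e.out k)
        = y t (e.out k) + if t = t₀ then (if k = k₀ then φ (y t v) else 0) else 0 := by
      intro y t
      simp only [T₆, Pi.add_apply, Pi.single_apply, e.injective.eq_iff, Sum.inr.injEq,
        Sum.inl.injEq]
      split_ifs <;> rfl
    rw [q₆, q₅, p₅ _ _ _ (hvo' k), p₄ _ _ _ (hvo' k), p₃ _ _ _ (huo k), p₂ _ _ _ (huo k),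
      p₁ _ _ _ (huo k) (hvo' k)]
    congr 1
    by_cases ht : t = t₀
    · subst ht
      by_cases hk : k = k₀
      · subst hk; simp
      · simp [hk]
    · simp [ht]

lemma computes_expSpan {σ : ℝ → ℝ} (hσ : IsNondegenerate σ) (e : Registers d dx dy)
    (r : Fin N → ℝ) (hr : Function.Injective r) (t₀ : Fin N) (k₀ : Fin dy)
    (h : Sequence dx N → ℝ) (hh : h ∈ expSpan (Sequence dx N)) : ∀ c : ℝ,
    Computes σ e r (fun x => Pi.single t₀ (Pi.single k₀ (c * h x))) := by
  induction hh using Submodule.span_induction with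
  | mem h hh =>
    obtain ⟨l, rfl⟩ := hh
    intro c
    -- The coefficient is absorbed into the profile.
    exact computes_ridge hσ e r hr t₀ k₀ l (fun z => c * Real.exp z) (by fun_prop)
  | zero =>
    intro c
    convert Computes.zero hσ e r using 1
    funext x
    simp
  | add p q _ _ hp hq =>
    intro c
    convert (hp c).add hσ (hq c) using 1
    funext x
    simp [mul_add, Pi.single_add]
  | smul a q _ hq =>
    intro c
    simpa [mul_assoc] using hq (c * a)

/-- Every continuous map is approximated on compact sets by computable maps. -/
lemma exists_computes {σ : ℝ → ℝ} (hσ : IsNondegenerate σ) (e : Registers d dx dy)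
    (r : Fin N → ℝ) (hr : Function.Injective r) (f : Sequence dx N → Sequence dy N)
    (hf : Continuous f) (C : Set (Sequence dx N)) (hC : IsCompact C) (ε : ℝ) (hε : 0 < ε) :
    ∃ F, Computes σ e r F ∧ ∀ x ∈ C, ∀ t k, |f x t k - F x t k| < ε := by
  have hfc : ∀ t k, Continuous fun x => f x t k := fun t k =>
    (continuous_apply k).comp ((continuous_apply t).comp hf)
  choose h hh hfh using fun t k => isCompactLimit_expSpan _ (hfc t k) C hC ε hε
  refine ⟨∑ p : Fin N × Fin dy, fun x => Pi.single p.1 (Pi.single p.2 (1 * h p.1 p.2 x)),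
    Computes.sum hσ _ _ fun p _ => computes_expSpan hσ e r hr p.1 p.2 _ (hh p.1 p.2) 1,
    fun x hx t k => ?_⟩
  convert hfh t k x hx using 3
  rw [Finset.sum_apply, Finset.sum_apply, Finset.sum_apply, Finset.sum_eq_single (t, k)]
  · simp
  · rintro ⟨t', k'⟩ _ hne
    by_cases ht : t = t'
    · subst ht
      have hk : k ≠ k' := fun hk => hne (by rw [hk])
      simp [hk]
    · simp [ht]
  · simp

/-! ### Assembling the network -/

lemma norm_toLp_le {n : ℕ} (v : Fin n → ℝ) (η : ℝ) (hη : 0 ≤ η) (hv : ∀ k, |v k| ≤ η) :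
    ‖(WithLp.toLp 2 v : EuclideanSpace ℝ (Fin n))‖ ≤ (n + 1) * η := by
  rw [EuclideanSpace.norm_eq]
  apply Real.sqrt_le_iff.2 ⟨by positivity, ?_⟩
  calc ∑ i, ‖v i‖ ^ 2 ≤ ∑ _i : Fin n, η ^ 2 :=
        Finset.sum_le_sum fun i _ => pow_le_pow_left₀ (norm_nonneg _) (hv i) 2
    _ = n * η ^ 2 := by simp
    _ ≤ ((n + 1) * η) ^ 2 := by
        rw [mul_pow]
        gcongr
        nlinarith [(Nat.cast_nonneg n : (0 : ℝ) ≤ n)]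

/-- Deep bidirectional networks with three additional coordinates are universal. -/
lemma exists_deep_brnn {σ : ℝ → ℝ} (hσ : IsNondegenerate σ) (e : Registers d dx dy)
    (f : Sequence dx N → Sequence dy N) (hf : Continuous f) (C : Set (Sequence dx N))
    (hC : IsCompact C) (ε : ℝ) (hε : 0 < ε) :
    ∃ M : BRNN dx d dy, M.IsDeep ∧ ∀ x ∈ C, ∀ t k, |f x t k - M.eval σ x t k| < ε := by
  obtain ⟨z₀, s, hs, h⟩ := hσ.exists_hasStrictDerivAt
  obtain ⟨r, hr, hclock⟩ := realizable_clock (N := N) σ z₀ s hs h hσ.continuous (e.aux 0)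
  obtain ⟨F, ⟨T, hT, hTF⟩, hFf⟩ := exists_computes hσ e r hr f hf C hC (ε / 2) (half_pos hε)
  let P : Matrix (Fin d) (Fin dx) ℝ := Matrix.of fun a i => if a = e.inp i then 1 else 0
  let Q : Matrix (Fin dy) (Fin d) ℝ := Matrix.of fun k a => if a = e.out k then 1 else 0
  have hPi : ∀ y i, (P *ᵥ y) (e.inp i) = y i := fun y i => by
    simp [P, Matrix.mulVec, dotProduct, e.injective.eq_iff]
  have hPo : ∀ y k, (P *ᵥ y) (e.out k) = 0 := fun y k => by
    simp [P, Matrix.mulVec, dotProduct, e.injective.eq_iff]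
  have hQ : ∀ y k, (Q *ᵥ y) k = y (e.out k) := fun y k => by
    simp [Q, Matrix.mulVec, dotProduct]
  let lift : Sequence dx N → Sequence d N := fun x t => P *ᵥ x t
  have hlift : Continuous lift := continuous_pi fun t =>
    continuous_const.matrix_mulVec (continuous_apply t)
  have hm : Set.MapsTo (fun (x : Sequence d N) t => Function.update (x t) (e.aux 0) (r t))
      Set.univ (clockSet (e.aux 0) r) := fun x _ t => Function.update_self ..
  -- Composing the clock with the program gives at least two cells, hence depth.
  obtain ⟨L, hL, hd⟩ := hclock.exists_comp hT hσ.continuous hm (lift '' C) (Set.subset_univ _)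
    (hC.image hlift) (ε / 2) (half_pos hε)
  refine ⟨⟨P, L, Q⟩, hL, fun x hx t k => ?_⟩
  have h1 := hd _ (Set.mem_image_of_mem lift hx)
  obtain ⟨-, -, h2⟩ := hTF _ (hm (Set.mem_univ (lift x)))
  have h3 := (dist_le_pi_dist _ _ (e.out k)).trans_lt ((dist_le_pi_dist _ _ t).trans_lt h1)
  rw [h2, Real.dist_eq] at h3
  have h4 : (fun t i => Function.update (lift x t) (e.aux 0) (r t) (e.inp i)) = x := by
    funext t i
    rw [Function.update_of_ne (e.injective.ne (by simp))]
    exact hPi _ _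
  rw [h4] at h3
  beta_reduce at h3
  rw [Function.update_of_ne (e.injective.ne (by simp))] at h3
  have h5 : lift x t (e.out k) = 0 := hPo _ _
  have h6 : BRNN.eval σ ⟨P, L, Q⟩ x t k = run σ L (lift x) t (e.out k) := hQ _ _
  rw [h5, zero_add, abs_sub_comm] at h3
  rw [h6]
  have := abs_sub_le (f x t k) (F x t k) (run σ L (lift x) t (e.out k))
  linarith [hFf x hx t k]

end DeepBRNN

theorem mainTheorem4 (dx dy N : ℕ) (σ : ℝ → ℝ) (hσ : DeepBRNN.IsNondegenerate σ)
    (f : DeepBRNN.Sequence dx N → DeepBRNN.Sequence dy N) (hf : Continuous f)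
    (K : Set (Fin dx → ℝ)) (hK : IsCompact K) (ε : ℝ) (hε : 0 < ε) :
    ∃ M : DeepBRNN.BRNN dx (dx + dy + 3 + DeepBRNN.alpha σ) dy,
      M.IsDeep ∧
      (⨆ x ∈ Set.univ.pi (fun _ : Fin N => K), ⨆ t : Fin N,
        ‖(WithLp.toLp 2 (f x t - M.eval σ x t) : EuclideanSpace ℝ (Fin dy))‖ₑ)
          < ENNReal.ofReal ε := by
  obtain ⟨e⟩ : Nonempty (DeepBRNN.Registers (dx + dy + 3 + DeepBRNN.alpha σ) dx dy) := by
    apply Function.Embedding.nonempty_of_card_le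
    simp only [Fintype.card_sum, Fintype.card_fin]
    omega
  obtain ⟨M, hM, h⟩ := DeepBRNN.exists_deep_brnn hσ e f hf (Set.univ.pi fun _ => K)
    -- The factor `dy + 1` pays for passing from coordinates to the Euclidean norm; halving `ε`
    -- keeps the inequality strict after the supremum.
    (isCompact_univ_pi fun _ => hK) (ε / 2 / (dy + 1)) (by positivity)
  refine ⟨M, hM, lt_of_le_of_lt ?_ ((ENNReal.ofReal_lt_ofReal_iff hε).2 (half_lt_self hε))⟩
  refine iSup₂_le fun x hx => iSup_le fun t => ?_
  rw [← ofReal_norm]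
  apply ENNReal.ofReal_le_ofReal
  refine (DeepBRNN.norm_toLp_le _ _ (by positivity) fun k => (h x hx t k).le).trans_eq ?_
  field_simp
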